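/- Let $V$ be a finite-dimensional complex vector space, $\Gamma\subset V$ a lattice, $W\subset GL(V)$ a finite subgroup preserving $\Gamma$, and $X=V/\Gamma$ the complex torus with the induced $W$-action. A reflection is a nontrivial semisimple element of $GL(V)$ fixing a hyperplane pointwise; a reflection hypertorus is a connected component, of codimension $1$, of the fixed locus $X^g$ of a reflection $g\in W$. For a reflection hypertorus $H$, let $W_H\subset W$ be the stabilizer of a generic point of $H$, let $n_H=|W_H|$, let $g_H\in W_H$ be the generator of the cyclic group $W_H$ with determinant $e^{2\pi i/n_H}$, and let $V_H^*\subset V^*$ be the line of linear forms vanishing on $V^{g_H}$. Let $V^\vee$ be the space of antilinear forms on $V$, put $\omega(\alpha,v)=\operatorname{Im}\alpha(v)$ and $\Gamma^\vee=\{\alpha\in V^\vee:\omega(\alpha,\Gamma)\subset\mathbb Z\}$, and let $W$ act on $V^\vee$ by $\omega(w\alpha,wv)=\omega(\alpha,v)$. For $\alpha\in V^\vee$ let $\mathcal L_\alpha$ be the holomorphic line bundle on $X$ which is the quotient of $V\times\mathbb C$ by the $\Gamma$-action $\gamma(z,\xi)=(z+\gamma,e^{2\pi i\omega(\alpha,\gamma)}\xi)$.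 Fix $\alpha$ such that $w\alpha-\alpha\notin\Gamma^\vee$ for all $w\in W$, $w\neq1$, and set $\mathcal L=\mathcal L_\alpha$ and $\mathcal L^w=\mathcal L_{w\alpha}$ for $w\in W$. The map $[z,\xi]\mapsto[w^{-1}z,\xi]$ identifies the fiber of $\mathcal L^w$ at $x$ with the fiber of $\mathcal L$ at $w^{-1}x$; in particular it trivializes $(\mathcal L^w)^*\otimes\mathcal L$ canonically over $X^w$. Then for every reflection hypertorus $H$ and every $j=1,\dots,n_H-1$: (1) the line bundle $(\mathcal L^{g_H^j})^*\otimes\mathcal L$ has a global meromorphic section $s$ which has a simple pole on $H$ and no other singularities, and every other such section is a scalar multiple of $s$; (2) the bundle $(\mathcal L^{g_H^j})^*\otimes\mathcal L\otimes V_H^*$ has a unique global meromorphic section $f_{H,j}^{\mathcal L}$ which has a simple pole on $H$, no other singularities, and Poincaré residue $1$ on $H$. Here $V^*$ is identified with the fibers of $T^*X$, so that the residue is a section of $(\mathcal L^{g_H^j})^*\otimes\mathcal L$ over $H$, which is regarded as a function on $H$ through the canonical trivialization above. -/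

import Mathlib

noncomputable section

open Set Filter Topology

namespace EllipticDunkl

variable {V : Type*} [NormedAddCommGroup V] [NormedSpace ℂ V]

/-! ### Groups acting on a complex torus -/

/-- The subgroup of `GL(V)` of all elements preserving `Γ`. A subgroup of `GL(V)` preserving `Γ`
is the same as a subgroup of `latticeAut Γ`. -/
def latticeAut (Γ : Submodule ℤ V) : Subgroup (V ≃ₗ[ℂ] V) where
  carrier := {g | ∀ v, g v ∈ Γ ↔ v ∈ Γ}
  one_mem' := fun _ => Iff.rfl
  mul_mem' := fun {a b} ha hb v => (ha (b v)).trans (hb v)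
  inv_mem' := fun {a} ha v => by
    have h := ha (a⁻¹ v)
    have e : a (a⁻¹ v) = v := a.apply_symm_apply v
    rw [e] at h
    exact h.symm

/-- The action on the torus `X = V ⧸ Γ` induced from the linear action on `V`. -/
instance torusAction (Γ : Submodule ℤ V) : MulAction (latticeAut Γ) (V ⧸ Γ) where
  smul g := Γ.mapQ Γ ((g : V ≃ₗ[ℂ] V).toLinearMap.restrictScalars ℤ)
    (fun v hv => (g.2 v).2 hv)
  one_smul x := by
    induction x using Submodule.Quotient.induction_on with
    | _ z => rfl
  mul_smul g h x := by
    induction x using Submodule.Quotient.induction_on with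
    | _ z => rfl

/-- The covering map `V → X = V ⧸ Γ`. -/
def proj (Γ : Submodule ℤ V) (z : V) : V ⧸ Γ := Submodule.Quotient.mk z

theorem smul_proj (Γ : Submodule ℤ V) (g : latticeAut Γ) (z : V) :
    g • proj Γ z = proj Γ ((g : V ≃ₗ[ℂ] V) z) := rfl

/-- A reflection: a nontrivial semisimple element of `GL(V)` fixing a hyperplane pointwise. -/
def IsReflection (g : V ≃ₗ[ℂ] V) : Prop :=
  g ≠ 1 ∧ Module.End.IsSemisimple (g : V →ₗ[ℂ] V) ∧
    ∃ P : Submodule ℂ V, Module.finrank ℂ P + 1 = Module.finrank ℂ V ∧ ∀ v ∈ P, g v = v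

/-- `H ⊆ X` is a smooth, locally affine, subset of codimension one: near each of its points its
preimage in `V` is a translate of a complex hyperplane. -/
def HasCodimOne (Γ : Submodule ℤ V) (H : Set (V ⧸ Γ)) : Prop :=
  ∀ z : V, proj Γ z ∈ H → ∃ P : Submodule ℂ V, Module.finrank ℂ P + 1 = Module.finrank ℂ V ∧
    ∀ᶠ y in 𝓝 z, proj Γ y ∈ H ↔ y - z ∈ P

/-- A reflection hypertorus: a connected component, of codimension one, of the fixed locus `X^g`
of a reflection `g ∈ W`. -/
def IsReflectionHypertorus {Γ : Submodule ℤ V} (W : Subgroup (latticeAut Γ))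
    (H : Set (V ⧸ Γ)) : Prop :=
  ∃ g : W, IsReflection ((g : latticeAut Γ) : V ≃ₗ[ℂ] V) ∧
    (∃ x ∈ MulAction.fixedBy (V ⧸ Γ) g,
      H = connectedComponentIn (MulAction.fixedBy (V ⧸ Γ) g) x) ∧
    HasCodimOne Γ H

/-- `W_H`, the stabilizer in `W` of a generic point of `H`: the elements of `W` fixing `H`
pointwise. (For any other `w ∈ W` the fixed points of `w` on `H` form a nowhere dense closed
analytic subset of `H`.) -/
def genericStabilizer {Γ : Submodule ℤ V} (W : Subgroup (latticeAut Γ)) (H : Set (V ⧸ Γ)) :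
    Subgroup W :=
  fixingSubgroup W H

/-- `n_H`, the order of `W_H`. -/
def genericOrder {Γ : Submodule ℤ V} (W : Subgroup (latticeAut Γ)) (H : Set (V ⧸ Γ)) : ℕ :=
  Nat.card (genericStabilizer W H)

/-- `g` is the generator `g_H` of `W_H`: the element of `W_H` of determinant `exp(2πi/n_H)`. -/
def IsDistinguishedGenerator {Γ : Submodule ℤ V} (W : Subgroup (latticeAut Γ))
    (H : Set (V ⧸ Γ)) (g : W) : Prop :=
  g ∈ genericStabilizer W H ∧
    LinearMap.det (((g : latticeAut Γ) : V ≃ₗ[ℂ] V) : V →ₗ[ℂ] V) =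
      Complex.exp (2 * Real.pi * Complex.I / (genericOrder W H : ℂ))

/-- The summand `V_H^*` in `V^* = (V^*)^g ⊕ V_H^*`, `g = g_H`: the linear forms on `V` vanishing on
`V^g`. -/
def dualVH (g : V ≃ₗ[ℂ] V) : Submodule ℂ (V →L[ℂ] ℂ) where
  carrier := {φ | ∀ v, g v = v → φ v = 0}
  add_mem' := fun {a b} ha hb v hv => by simp [ha v hv, hb v hv]
  zero_mem' := fun _ _ => rfl
  smul_mem' := fun c a ha v hv => by simp [ha v hv]

/-! ### Holomorphic bundles on a complex torus -/

/-- A factor of automorphy `χ(γ, z)`. -/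
structure AutFactor (Γ : Submodule ℤ V) where
  toFun : Γ → V → ℂˣ
  holo : ∀ γ, AnalyticOnNhd ℂ (fun z => (toFun γ z : ℂ)) univ
  cocycle : ∀ γ₁ γ₂ z, toFun (γ₁ + γ₂) z = toFun γ₁ (z + γ₂) * toFun γ₂ z

namespace AutFactor

variable {Γ : Submodule ℤ V}

/-- The factor of automorphy of the tensor product of two line bundles. -/
def tensor (χ ψ : AutFactor Γ) : AutFactor Γ where
  toFun γ z := χ.toFun γ z * ψ.toFun γ z
  holo γ := by
    simp only [Units.val_mul]
    exact (χ.holo γ).mul (ψ.holo γ)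
  cocycle γ₁ γ₂ z := by
    rw [χ.cocycle, ψ.cocycle, mul_mul_mul_comm]

/-- The factor of automorphy of the dual line bundle. -/
def dual (χ : AutFactor Γ) : AutFactor Γ where
  toFun γ z := (χ.toFun γ z)⁻¹
  holo γ := by
    simp only [Units.val_inv_eq_inv_val]
    exact (χ.holo γ).inv (fun z _ => (χ.toFun γ z).ne_zero)
  cocycle γ₁ γ₂ z := by
    rw [χ.cocycle, mul_inv]

theorem map_zero (χ : AutFactor Γ) (z : V) : χ.toFun 0 z = 1 := by
  have h := χ.cocycle 0 0 z
  simpa using h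

end AutFactor

section Bundle

variable {Γ : Submodule ℤ V} (χ : AutFactor Γ) (U : Type*) [NormedAddCommGroup U] [NormedSpace ℂ U]

/-- The equivalence relation on `V × U` of the `Γ`-action `γ (z, u) = (z + γ, χ(γ, z) u)`. -/
def bundleSetoid : Setoid (V × U) where
  r p q := ∃ γ : Γ, q = (p.1 + γ, (χ.toFun γ p.1 : ℂ) • p.2)
  iseqv :=
    { refl := fun p => ⟨0, by simp [χ.map_zero]⟩
      symm := by
        rintro p _ ⟨γ, rfl⟩
        refine ⟨-γ, ?_⟩
        have h := χ.cocycle (-γ) γ p.1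
        rw [neg_add_cancel, χ.map_zero] at h
        ext
        · simp
        · simp only [smul_smul, ← Units.val_mul, ← h, Units.val_one, one_smul]
      trans := by
        rintro p _ _ ⟨γ, rfl⟩ ⟨δ, rfl⟩
        refine ⟨δ + γ, ?_⟩
        ext
        · simp [add_assoc, add_comm (δ : V)]
        · simp only [smul_smul, ← Units.val_mul, ← χ.cocycle] }

/-- The total space of the holomorphic vector bundle `𝓛(χ) ⊗ U` on `X`: the quotient of `V × U` by
the `Γ`-action `γ (z, u) = (z + γ, χ(γ, z) u)`. For `U = ℂ` it is the line bundle `𝓛(χ)`. -/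
def Bundle : Type _ := Quotient (bundleSetoid χ U)

variable {U}

/-- The class of `(z, u)` in the total space. -/
def Bundle.mk (z : V) (u : U) : Bundle χ U := Quotient.mk (bundleSetoid χ U) (z, u)

variable {χ}

/-- The bundle projection to `X`. -/
def Bundle.base : Bundle χ U → V ⧸ Γ :=
  Quotient.lift (fun p => proj Γ p.1) (by
    rintro p _ ⟨γ, rfl⟩
    refine (Submodule.Quotient.eq Γ).2 ?_
    simp)

/-- Fibrewise multiplication by a scalar. -/
def Bundle.smul (c : ℂ) : Bundle χ U → Bundle χ U :=
  Quotient.map (fun p => (p.1, c • p.2)) (by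
    rintro p _ ⟨γ, rfl⟩
    exact ⟨γ, by simp [smul_comm c]⟩)

variable (χ U)

/-- (Set-theoretic) sections of `𝓛(χ) ⊗ U` over `X ∖ H`. -/
structure SectionOff (H : Set (V ⧸ Γ)) where
  toFun : {x : V ⧸ Γ // x ∉ H} → Bundle χ U
  base_eq : ∀ x, (toFun x).base = x

variable {χ U} {H : Set (V ⧸ Γ)}

/-- `f` is the function on (the preimage of `X ∖ H` in) `V` describing the section `s`, i.e. the
pull-back of `s` to `V` in the tautological trivialization. Values of `f` over `H` are
irrelevant. -/
def SectionOff.IsLift (s : SectionOff χ U H) (f : V → U) : Prop :=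
  ∀ (z : V) (hz : proj Γ z ∉ H), s.toFun ⟨proj Γ z, hz⟩ = Bundle.mk χ z (f z)

/-- The section is holomorphic on `X ∖ H` (the covering `V → X` being locally biholomorphic, this
means that its pull-back to `V` is holomorphic). -/
def SectionOff.IsHolomorphic (s : SectionOff χ U H) : Prop :=
  ∃ f : V → U, s.IsLift f ∧ AnalyticOnNhd ℂ f {z | proj Γ z ∉ H}

/-- Near `z`, the set `Z ⊆ V` is the zero locus of the nonzero linear coordinate `y ↦ ℓ (y - z)`,
and off `Z` one has `f = h / ℓ(· - z)`, where `h` is holomorphic near `z`. -/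
def IsPolarForm (Z : Set V) (f : V → U) (z : V) (ℓ : V →L[ℂ] ℂ) (h : V → U) : Prop :=
  ℓ ≠ 0 ∧ AnalyticAt ℂ h z ∧ (∀ᶠ y in 𝓝 z, y ∈ Z ↔ ℓ (y - z) = 0) ∧
    ∀ᶠ y in 𝓝 z, y ∉ Z → f y = (ℓ (y - z))⁻¹ • h y

/-- A section which is holomorphic on `X ∖ H` has a simple pole on the hypersurface `H`: near each
point of `H` it is the quotient of a holomorphic section by a local equation of `H`, the numerator
not being identically zero on `H`. -/
def SectionOff.HasSimplePole (s : SectionOff χ U H) : Prop :=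
  ∀ f : V → U, s.IsLift f → ∀ z : V, proj Γ z ∈ H →
    ∃ ℓ h, IsPolarForm {y | proj Γ y ∈ H} f z ℓ h ∧ ∃ᶠ y in 𝓝[{y | proj Γ y ∈ H}] z, h y ≠ 0

/-- A meromorphic section on `X` with a simple pole on `H` and no other singularities. -/
def SectionOff.IsMeromorphicWithSimplePole (s : SectionOff χ U H) : Prop :=
  s.IsHolomorphic ∧ s.HasSimplePole

/-- The Poincaré residue along `H` of the section `s` of `𝓛(χ) ⊗ F`, where `F ⊆ V^*` and `V^*` is
the fibre of `T^*X`, is the section `r` of `𝓛(χ)` over `H`: if near a point of `H` one has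
`s = h / ℓ` with `ℓ` a linear coordinate vanishing on `H`, and `h` a holomorphic family of
covectors, then `h = c • dℓ` at that point, with `c` the value of `r`. -/
def SectionOff.HasResidue {F : Submodule ℂ (V →L[ℂ] ℂ)} (s : SectionOff χ F H)
    (r : H → Bundle χ ℂ) : Prop :=
  ∀ f : V → F, s.IsLift f → ∀ (z : V) (hz : proj Γ z ∈ H),
    ∃ ℓ h, IsPolarForm {y | proj Γ y ∈ H} f z ℓ h ∧
      ∃ c : ℂ, (h z : V →L[ℂ] ℂ) = c • ℓ ∧ r ⟨proj Γ z, hz⟩ = Bundle.mk χ z c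

end Bundle

/-! ### The dual torus and topologically trivial line bundles -/

/-- `V^∨`, the antilinear forms on `V`. -/
abbrev AntiDual (V : Type*) [NormedAddCommGroup V] [NormedSpace ℂ V] : Type _ := V →ₗ⋆[ℂ] ℂ

/-- The real bilinear form `ω(α, v) = Im α(v)`. -/
def omega (α : AntiDual V) (v : V) : ℝ := (α v).im

/-- The dual lattice `Γ^∨ = {α | ω(α, Γ) ⊆ ℤ}`; the dual torus is `X^∨ = V^∨ ⧸ Γ^∨`. -/
def dualLattice (Γ : Submodule ℤ V) : AddSubgroup (AntiDual V) where
  carrier := {α | ∀ γ ∈ Γ, ∃ n : ℤ, omega α γ = n}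
  zero_mem' := fun _ _ => ⟨0, by simp [omega]⟩
  add_mem' := fun {a b} ha hb γ hγ => by
    obtain ⟨m, hm⟩ := ha γ hγ
    obtain ⟨n, hn⟩ := hb γ hγ
    exact ⟨m + n, by simp only [omega] at hm hn ⊢; simp [hm, hn]⟩
  neg_mem' := fun {a} ha γ hγ => by
    obtain ⟨m, hm⟩ := ha γ hγ
    exact ⟨-m, by simp only [omega] at hm ⊢; simp [hm]⟩

/-- The action of `GL(V)` on `V^∨` dual to that on `V` with respect to `ω`. -/
def dualAct (g : V ≃ₗ[ℂ] V) (α : AntiDual V) : AntiDual V :=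
  α.comp (g.symm : V →ₗ[ℂ] V)

theorem omega_dualAct (g : V ≃ₗ[ℂ] V) (α : AntiDual V) (v : V) :
    omega (dualAct g α) (g v) = omega α v := by
  simp [omega, dualAct]

/-- The point of `X^∨` represented by `α` has trivial stabilizer in `W`. -/
def HasTrivialStabilizer {Γ : Submodule ℤ V} (W : Subgroup (latticeAut Γ)) (α : AntiDual V) :
    Prop :=
  ∀ w : W, (QuotientAddGroup.mk (dualAct ((w : latticeAut Γ) : V ≃ₗ[ℂ] V) α) :
    AntiDual V ⧸ dualLattice Γ) = QuotientAddGroup.mk α → w = 1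

/-- The factor of automorphy `χ_α(γ, z) = exp(2πi ω(α, γ))` of the line bundle `𝓛_α`. -/
def charFactor (Γ : Submodule ℤ V) (α : AntiDual V) : AutFactor Γ where
  toFun γ _ := Units.mk0 (Complex.exp (2 * Real.pi * Complex.I * (omega α γ : ℂ)))
    (Complex.exp_ne_zero _)
  holo _ := analyticOnNhd_const
  cocycle γ₁ γ₂ z := by
    ext
    simp only [omega, Submodule.coe_add, map_add, Complex.add_im, Complex.ofReal_add, mul_add,
      Complex.exp_add, Units.val_mk0, Units.val_mul]

/-- The factor of automorphy of `(𝓛^g)^* ⊗ 𝓛`, where `𝓛 = 𝓛_α` and `𝓛^g = 𝓛_{gα}`. -/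
def twistFactor (Γ : Submodule ℤ V) (α : AntiDual V) (g : V ≃ₗ[ℂ] V) : AutFactor Γ :=
  (charFactor Γ (dualAct g α)).dual.tensor (charFactor Γ α)

/-- The canonical isomorphism of `𝓛^g` with the pull-back of `𝓛` by `g⁻¹`, as a map from the total
space of `𝓛^g` to that of `𝓛` which lies over `g⁻¹ : X → X`. -/
def twistMap {Γ : Submodule ℤ V} (α : AntiDual V) (g : latticeAut Γ) :
    Bundle (charFactor Γ (dualAct (g : V ≃ₗ[ℂ] V) α)) ℂ → Bundle (charFactor Γ α) ℂ :=
  Quotient.map (fun p => ((g : V ≃ₗ[ℂ] V).symm p.1, p.2)) (by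
    rintro p _ ⟨γ, rfl⟩
    refine ⟨⟨(g : V ≃ₗ[ℂ] V).symm γ, ?_⟩, ?_⟩
    · exact ((g⁻¹).2 (γ : V)).2 γ.2
    · ext
      · simp
      · simp [charFactor, omega, dualAct])

theorem base_twistMap {Γ : Submodule ℤ V} (α : AntiDual V) (g : latticeAut Γ)
    (e : Bundle (charFactor Γ (dualAct (g : V ≃ₗ[ℂ] V) α)) ℂ) :
    (twistMap α g e).base = g⁻¹ • e.base := by
  induction e using Quotient.inductionOn with
  | _ p => rfl

/-- The section `r` of `(𝓛^g)^* ⊗ 𝓛` over a subset `H` of the fixed locus `X^g` is the constant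
function `1`: over a point `x ∈ X^g` the fibre of `𝓛^g` is the fibre of `𝓛` at `g⁻¹x = x`, which
trivializes `(𝓛^g)^* ⊗ 𝓛` canonically. That is, the class of `(z, c)`, regarded as the linear map
`[z, ξ] ↦ [z, cξ]` from the fibre of `𝓛^g` to that of `𝓛`, is the canonical identification. -/
def IsUnitSection {Γ : Submodule ℤ V} (α : AntiDual V) (g : latticeAut Γ) {H : Set (V ⧸ Γ)}
    (r : H → Bundle (twistFactor Γ α (g : V ≃ₗ[ℂ] V)) ℂ) : Prop :=
  ∀ (z : V) (hz : proj Γ z ∈ H), ∃ c : ℂ,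
    r ⟨proj Γ z, hz⟩ = Bundle.mk _ z c ∧
      ∀ ξ : ℂ, Bundle.mk (charFactor Γ α) z (c * ξ) = twistMap α g (Bundle.mk _ z ξ)

end EllipticDunkl

end

open EllipticDunkl

/-! The problem reduces to one on an elliptic curve. The reflection `g` defining `H` satisfies `g z
- z = ℓ z • v₁` for a linear form `ℓ`. Since `g` preserves `Γ`, `ℓ(Γ) • v₁ ⊆ Γ`, so `ℓ(Γ)` is a
lattice in `ℂ`, and the preimage of `H` in `V` is the set where `ℓ(z - z₀) ∈ ℓ(Γ)`
(`proj_mem_connectedComponentIn_iff`). Every element of `W_H` fixes `ker ℓ` pointwise. Hence, for `w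
= g_H ^ j`, the form `α - wα` vanishes on `ker ℓ`, and the multiplier of the bundle at `γ` is `κ(ℓ
γ)` for a unitary character `κ` of `ℂ`. As `w ≠ 1` and `α` has trivial stabilizer, `κ` is nontrivial
on `ℓ(Γ)`.

Existence: on `ℂ` a twisted Weierstrass zeta function, corrected by an affine function, has
multipliers `κ` and a simple pole at each lattice point (`exists_quasiperiodic`). Its pullback along
`z ↦ ℓ(z - z₀)` is the section.

Uniqueness: two sections with equal residues differ by a function with bounded norm, which is
constant by Liouville on complex lines, hence zero because `κ` is nontrivial (`eq_of_residue_eq`). A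
residue is bounded and holomorphic on `z₀ + ker ℓ`, so it is constant there and is determined by one
value (`residue_eq`); this gives (1). For (2), the canonical trivialization over `H` is `z ↦ κ(ℓ
z)`, which is the residue of the model multiplied by `κ(ℓ z₀)` and `dℓ`. -/

noncomputable section

open Set Filter Topology

namespace EllipticDunkl

/-! ### Twisted Weierstrass zeta functions on an elliptic curve. -/

section TwistedZeta

variable (L : Submodule ℤ ℂ) (χ : ℂ → ℂ)

/-- The term of index `l` of the twisted Weierstrass zeta function. -/
def zetaTerm (l z : ℂ) : ℂ := χ l * ((z - l)⁻¹ + l⁻¹ + z * (l⁻¹) ^ 2)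

/-- The twisted Weierstrass zeta function `∑ χ(l) (1 / (z - l) + 1 / l + z / l²)`. -/
def twistedZeta (z : ℂ) : ℂ := ∑' l : L, zetaTerm χ l z

variable {L χ}

/-- The two correction terms cancel the expansion of `1 / (z - l)` to second order: the bracket
equals `z² / (l² (z - l))`, and cubic decay is summable over a lattice of rank 2. -/
theorem norm_zetaTerm_le (hχ : ∀ u, ‖χ u‖ = 1) {R : ℝ} {l z : ℂ} (hR : 0 < R) (hz : ‖z‖ < R)
    (hl : 2 * R ≤ ‖l‖) : ‖zetaTerm χ l z‖ ≤ 2 * R ^ 2 * ‖l‖⁻¹ ^ 3 := by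
  have hl0 : 0 < ‖l‖ := by linarith
  have hne : l ≠ 0 := norm_pos_iff.1 hl0
  have hd : ‖l‖ / 2 ≤ ‖z - l‖ := by
    have := norm_sub_norm_le l z
    rw [norm_sub_rev] at this
    linarith
  have hd0 : 0 < ‖z - l‖ := by linarith
  have hne' : z - l ≠ 0 := norm_pos_iff.1 hd0
  have e : (z - l)⁻¹ + l⁻¹ + z * (l⁻¹) ^ 2 = z ^ 2 * (l⁻¹) ^ 2 * (z - l)⁻¹ := by
    field_simp
    ring
  rw [zetaTerm, norm_mul, hχ, one_mul, e, norm_mul, norm_mul, norm_pow, norm_pow, norm_inv,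
    norm_inv]
  have h1 : ‖z - l‖⁻¹ ≤ 2 * ‖l‖⁻¹ := by
    rw [show 2 * ‖l‖⁻¹ = (‖l‖ / 2)⁻¹ by field_simp]
    exact inv_anti₀ (by positivity) hd
  have h2 : ‖z‖ ^ 2 ≤ R ^ 2 := by gcongr
  calc ‖z‖ ^ 2 * ‖l‖⁻¹ ^ 2 * ‖z - l‖⁻¹ ≤ R ^ 2 * ‖l‖⁻¹ ^ 2 * (2 * ‖l‖⁻¹) := by gcongr
    _ = _ := by ring

theorem finite_norm_lt [DiscreteTopology L] (R : ℝ) : {l : L | ‖(l : ℂ)‖ < R}.Finite := by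
  have h : ((Metric.ball (0 : ℂ) R) ∩ (L : Set ℂ)).Finite :=
    Metric.finite_isBounded_inter_isClosed DiscreteTopology.isDiscrete Metric.isBounded_ball
      (@AddSubgroup.isClosed_of_discrete _ _ _ _ _ L.toAddSubgroup _)
  refine (h.preimage Subtype.val_injective.injOn).subset fun l hl => ?_
  exact ⟨by simpa using hl, l.2⟩

theorem summable_cube [DiscreteTopology L] [IsZLattice ℝ L] :
    Summable fun l : L => ‖(l : ℂ)‖⁻¹ ^ 3 := by
  refine ZLattice.summable_norm_pow_inv (L := L) 3 ?_
  rw [ZLattice.rank ℝ L, Complex.finrank_real_complex]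
  norm_num

theorem summable_zetaTerm [DiscreteTopology L] [IsZLattice ℝ L] (hχ : ∀ u, ‖χ u‖ = 1) (z : ℂ) :
    Summable fun l : L => zetaTerm χ l z := by
  refine Summable.of_norm_bounded_eventually
    (g := fun l : L => 2 * (‖z‖ + 1) ^ 2 * ‖(l : ℂ)‖⁻¹ ^ 3) (summable_cube.mul_left _) ?_
  rw [Filter.eventually_cofinite]
  refine (finite_norm_lt (L := L) (2 * (‖z‖ + 1))).subset fun l hl => ?_
  by_contra h
  exact hl (norm_zetaTerm_le hχ (by positivity) (by linarith) (not_lt.1 h))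

theorem differentiableOn_tsum_zetaTerm [DiscreteTopology L] [IsZLattice ℝ L]
    (hχ : ∀ u, ‖χ u‖ = 1) {R : ℝ} (hR : 0 < R) :
    DifferentiableOn ℂ (fun z => ∑' l : {l : L // l ∉ (finite_norm_lt (L := L) (2 * R)).toFinset},
      zetaTerm χ l.1 z) (Metric.ball 0 R) := by
  have key : ∀ l : {l : L // l ∉ (finite_norm_lt (L := L) (2 * R)).toFinset},
      2 * R ≤ ‖(l.1 : ℂ)‖ := fun l => by simpa using l.2
  refine Complex.differentiableOn_tsum_of_summable_norm
    (u := fun l => 2 * R ^ 2 * ‖(l.1 : ℂ)‖⁻¹ ^ 3)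
    ((summable_cube.subtype _).mul_left _) (fun l => ?_) Metric.isOpen_ball (fun l z hz => ?_)
  · intro z hz
    have hz' : z - l.1 ≠ 0 := by
      intro h
      have := key l
      rw [← sub_eq_zero.1 h] at this
      rw [mem_ball_zero_iff] at hz
      linarith
    refine DifferentiableAt.differentiableWithinAt ?_
    unfold zetaTerm
    fun_prop (disch := exact hz')
  · exact norm_zetaTerm_le hχ hR (by simpa using hz) (key l)

/-- Near any point the twisted zeta function is a finite sum of its terms up to an analytic
function. -/
theorem exists_twistedZeta_eq_finset_sum [DiscreteTopology L] [IsZLattice ℝ L]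
    (hχ : ∀ u, ‖χ u‖ = 1) (z₀ : ℂ) (l₀ : L) : ∃ (s : Finset L) (g : ℂ → ℂ), l₀ ∈ s ∧
      AnalyticAt ℂ g z₀ ∧ ∀ z, twistedZeta L χ z = ∑ l ∈ s, zetaTerm χ l z + g z := by
  set R := ‖z₀‖ + ‖(l₀ : ℂ)‖ + 1 with hRdef
  have hR : 0 < R := by positivity
  refine ⟨_, _, ?_, ?_, fun z => ((summable_zetaTerm hχ z).sum_add_tsum_subtype_compl
    (finite_norm_lt (L := L) (2 * R)).toFinset).symm⟩
  · have := norm_nonneg z₀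
    have := norm_nonneg (l₀ : ℂ)
    simp only [Finite.mem_toFinset, mem_ofPred_eq]
    linarith
  · refine (differentiableOn_tsum_zetaTerm hχ hR).analyticAt (Metric.isOpen_ball.mem_nhds ?_)
    have := norm_nonneg (l₀ : ℂ)
    rw [mem_ball_zero_iff]
    linarith

theorem analyticAt_zetaTerm {l z : ℂ} (h : z ≠ l) : AnalyticAt ℂ (zetaTerm χ l) z := by
  have h' : z - l ≠ 0 := sub_ne_zero.2 h
  unfold zetaTerm
  fun_prop (disch := exact h')

theorem analyticAt_twistedZeta [DiscreteTopology L] [IsZLattice ℝ L] (hχ : ∀ u, ‖χ u‖ = 1)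
    {z : ℂ} (hz : z ∉ L) : AnalyticAt ℂ (twistedZeta L χ) z := by
  obtain ⟨s, g, -, hg, h⟩ := exists_twistedZeta_eq_finset_sum (L := L) hχ z 0
  rw [funext h]
  refine (Finset.analyticAt_fun_sum s fun l _ => ?_).add hg
  exact analyticAt_zetaTerm fun e => hz (e ▸ l.2)

/-- Since `0⁻¹ = 0`, the term of index `0` is just `z⁻¹`; all other terms are analytic at `0`. The
same convention makes the identity hold at `z = 0`. -/
theorem exists_twistedZeta_eq_inv_add [DiscreteTopology L] [IsZLattice ℝ L]
    (hχ : ∀ u, ‖χ u‖ = 1) (h0 : χ 0 = 1) :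
    ∃ h : ℂ → ℂ, AnalyticAt ℂ h 0 ∧ ∀ z, twistedZeta L χ z = z⁻¹ + h z := by
  classical
  obtain ⟨s, g, hs, hg, h⟩ := exists_twistedZeta_eq_finset_sum (L := L) hχ 0 0
  refine ⟨fun z => ∑ l ∈ s.erase 0, zetaTerm χ l z + g z, ?_, fun z => ?_⟩
  · refine (Finset.analyticAt_fun_sum _ fun l hl => ?_).add hg
    refine analyticAt_zetaTerm fun e => Finset.ne_of_mem_erase hl ?_
    exact Subtype.ext e.symm
  · rw [h, ← Finset.add_sum_erase s _ hs, add_assoc]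
    simp [zetaTerm, h0]

/-- The twisted zeta function is quasi-periodic up to affine functions. -/
theorem exists_twistedZeta_add [DiscreteTopology L] [IsZLattice ℝ L] (hχ : ∀ u, ‖χ u‖ = 1)
    (hadd : ∀ a b, χ (a + b) = χ a * χ b) (m : L) :
    ∃ a b : ℂ, ∀ z, twistedZeta L χ (z + m) - χ m * twistedZeta L χ z = a * z + b := by
  -- After the shift of index `l ↦ l + m`, the polar parts `χ(l + m) / (z - l)` cancel term by term;
  -- `A l` and `B l` are the coefficients of what remains.
  set A : L → ℂ := fun l => χ ((l + m : L) : ℂ) * ((((l + m : L) : ℂ)⁻¹) ^ 2 - ((l : ℂ)⁻¹) ^ 2)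
  set B : L → ℂ := fun l => χ ((l + m : L) : ℂ) * (((l + m : L) : ℂ)⁻¹ - (l : ℂ)⁻¹ +
    m * (((l + m : L) : ℂ)⁻¹) ^ 2)
  have hs : ∀ z, HasSum (fun l => A l * z + B l)
      (twistedZeta L χ (z + m) - χ m * twistedZeta L χ z) := by
    intro z
    have h1 : HasSum (fun l : L => zetaTerm χ ((l + m : L) : ℂ) (z + m))
        (twistedZeta L χ (z + m)) := by
      have h := (summable_zetaTerm (L := L) hχ (z + m)).hasSum
      rw [← (Equiv.addRight m).hasSum_iff] at h
      exact h
    have h2 := ((summable_zetaTerm (L := L) hχ z).hasSum).mul_left (χ m)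
    have e : (fun l => A l * z + B l) = fun l : L =>
        zetaTerm χ ((l + m : L) : ℂ) (z + m) - χ m * zetaTerm χ l z := by
      funext l
      simp only [A, B, zetaTerm, Submodule.coe_add, hadd, add_sub_add_right_eq_sub]
      ring
    rw [e]
    exact h1.sub h2
  -- Summability of the coefficients is read off from the values at `z = 0` and `z = 1`.
  have hB : Summable B := by simpa using (hs 0).summable
  have hA : Summable A := by
    have := (hs 1).summable.sub hB
    simpa using this
  exact ⟨∑' l, A l, ∑' l, B l, fun z =>
    (hs z).unique ((hA.hasSum.mul_right z).add hB.hasSum)⟩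

/-- For a nontrivial unitary character `χ` of a lattice in `ℂ` there is a meromorphic function with
multipliers `χ` whose only singularities are simple poles with residue `1` modulo the lattice. -/
theorem exists_quasiperiodic [DiscreteTopology L] [IsZLattice ℝ L] (hχ : ∀ u, ‖χ u‖ = 1)
    (hadd : ∀ a b, χ (a + b) = χ a * χ b) (hnt : ∃ n ∈ L, χ n ≠ 1) :
    ∃ f h : ℂ → ℂ, (∀ z, ∀ m ∈ L, f (z + m) = χ m * f z) ∧ AnalyticAt ℂ h 0 ∧
      (∀ z, f z = z⁻¹ + h z) ∧ ∀ z ∉ L, AnalyticAt ℂ f z := by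
  obtain ⟨n, hn, hn1⟩ := hnt
  have h0 : χ 0 = 1 := by
    have h := hadd 0 0
    have hne : χ 0 ≠ 0 := fun e => by simpa [e] using hχ 0
    rw [add_zero] at h
    exact mul_left_cancel₀ hne (by rw [mul_one]; exact h.symm)
  have hn1' : 1 - χ n ≠ 0 := sub_ne_zero.2 hn1.symm
  obtain ⟨a, b, hab⟩ := exists_twistedZeta_add (L := L) hχ hadd ⟨n, hn⟩
  obtain ⟨h, hh, hh'⟩ := exists_twistedZeta_eq_inv_add (L := L) hχ h0
  -- `A z + B` solves `A (z + n) + B - χ(n) (A z + B) = a z + b`, so subtracting it makes the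
  -- function exactly quasi-periodic under the single period `n`.
  set A := a / (1 - χ n) with hA
  set B := (b - A * n) / (1 - χ n) with hB
  have hA' : A * (1 - χ n) = a := div_mul_cancel₀ _ hn1'
  have hB' : B * (1 - χ n) = b - A * n := div_mul_cancel₀ _ hn1'
  set f : ℂ → ℂ := fun z => twistedZeta L χ z - (A * z + B) with hf
  have hfn : ∀ z, f (z + n) = χ n * f z := by
    intro z
    have e := hab z
    simp only [hf] at e ⊢
    linear_combination e - z * hA' - hB'
  refine ⟨f, fun z => h z - (A * z + B), ?_, by fun_prop, fun z => ?_, fun z hz => ?_⟩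
  · intro z m hm
    obtain ⟨p, q, hpq⟩ := exists_twistedZeta_add (L := L) hχ hadd ⟨m, hm⟩
    have hD : ∃ p' q' : ℂ, ∀ z, f (z + m) - χ m * f z = p' * z + q' := by
      refine ⟨p - A + χ m * A, q - A * m - B + χ m * B, fun z => ?_⟩
      have e := hpq z
      simp only [hf] at e ⊢
      linear_combination e
    obtain ⟨p', q', hD⟩ := hD
    -- Translations by `m` and `n` commute, so the affine defect for `m` is itself multiplied by
    -- `χ(n)` under `z ↦ z + n`. As `χ(n) ≠ 1`, an affine function with this property vanishes.
    have hDn : ∀ z, p' * (z + n) + q' = χ n * (p' * z + q') := by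
      intro z
      rw [← hD, ← hD, hfn, show z + n + m = z + m + n by ring, hfn]
      ring
    have e0 := hDn 0
    have e1 := hDn 1
    have hp : p' = 0 := by
      have : p' * (1 - χ n) = 0 := by linear_combination e1 - e0
      exact (mul_eq_zero.1 this).resolve_right hn1'
    have hq : q' = 0 := by
      have : q' * (1 - χ n) = 0 := by
        rw [hp] at e0
        linear_combination e0
      exact (mul_eq_zero.1 this).resolve_right hn1'
    have := hD z
    rw [hp, hq] at this
    linear_combination this
  · simp only [hf, hh']
    ring
  · exact (analyticAt_twistedZeta hχ hz).sub (by fun_prop)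

end TwistedZeta

end EllipticDunkl
end

noncomputable section

open Set Filter Topology

namespace EllipticDunkl

/-! ### Liouville's theorem with removable singularities. -/

section OneVariable

variable {U : Type*} [NormedAddCommGroup U] [NormedSpace ℂ U]

/-- Liouville's theorem for functions with isolated removable singularities. -/
theorem apply_eq_apply_of_bounded_off_discrete [CompleteSpace U] {g : ℂ → U} {S : Set ℂ} {C : ℝ}
    (hS : ∀ u, ∀ᶠ w in 𝓝[≠] u, w ∉ S) (hg : ∀ u ∉ S, DifferentiableAt ℂ g u)
    (hC : ∀ u ∉ S, ‖g u‖ ≤ C) {u w : ℂ} (hu : u ∉ S) (hw : w ∉ S) : g u = g w := by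
  -- Punctured limits extend `g` over `S`: they agree with `g` off `S`, and give the
  -- removable-singularity extension at points of `S`.
  set G : ℂ → U := fun u => limUnder (𝓝[≠] u) g with hG
  have hGg : ∀ u ∉ S, G u = g u := fun u hu =>
    ((hg u hu).continuousAt.tendsto.mono_left nhdsWithin_le_nhds).limUnder_eq
  have hd : Differentiable ℂ G := by
    intro u
    have h := hS u
    rw [eventually_nhdsWithin_iff] at h
    set s : Set ℂ := {w | w ∈ ({u} : Set ℂ)ᶜ → w ∉ S} with hs
    have hsn : s ∈ 𝓝 u := h
    have hsub : ∀ x ∈ s \ {u}, x ∉ S := fun x hx => hx.1 hx.2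
    have hD := Complex.differentiableOn_update_limUnder_of_bddAbove hsn
      (fun x hx => (hg x (hsub x hx)).differentiableWithinAt)
      ⟨C, by rintro _ ⟨x, hx, rfl⟩; exact hC x (hsub x hx)⟩
    have hD' := hD.differentiableAt hsn
    refine hD'.congr_of_eventuallyEq ?_
    filter_upwards [hsn] with x hx
    by_cases hxu : x = u
    · subst hxu
      simp [hG]
    · rw [Function.update_of_ne hxu, hGg x (hsub x ⟨hx, hxu⟩)]
  have hb : Bornology.IsBounded (range G) := by
    refine (Metric.isBounded_closedBall (x := (0 : U)) (r := C)).subset ?_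
    rintro _ ⟨u, rfl⟩
    rw [mem_closedBall_zero_iff]
    have hcont : Tendsto G (𝓝[≠] u) (𝓝 (G u)) :=
      (hd u).continuousAt.tendsto.mono_left nhdsWithin_le_nhds
    refine le_of_tendsto hcont.norm ?_
    filter_upwards [hS u] with x hx
    rw [hGg x hx]
    exact hC x hx
  rw [← hGg u hu, ← hGg w hw]
  exact hd.apply_eq_apply_of_bounded hb u w

end OneVariable

variable {V : Type*} [NormedAddCommGroup V] [NormedSpace ℂ V]

/-! ### Bounds from periodicity. -/

theorem exists_compact_translate [FiniteDimensional ℂ V] (Γ : Submodule ℤ V) [DiscreteTopology Γ]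
    [IsZLattice ℝ Γ] : ∃ K : Set V, IsCompact K ∧ ∀ y, ∃ γ ∈ Γ, y + γ ∈ K := by
  have : FiniteDimensional ℝ V := FiniteDimensional.complexToReal V
  have : ProperSpace V := FiniteDimensional.proper ℝ V
  have := ZLattice.module_free ℝ Γ
  have := ZLattice.module_finite ℝ Γ
  let b := (Module.Free.chooseBasis ℤ Γ).ofZLatticeBasis ℝ Γ
  refine ⟨closure (ZSpan.fundamentalDomain b),
    (ZSpan.fundamentalDomain_isBounded b).isCompact_closure, fun y => ?_⟩
  refine ⟨-(ZSpan.floor b y : V), Γ.neg_mem ?_, subset_closure ?_⟩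
  · exact ((Module.Free.chooseBasis ℤ Γ).ofZLatticeBasis_span ℝ Γ).le (ZSpan.floor b y).2
  · rw [← sub_eq_add_neg]
    exact ZSpan.fract_mem_fundamentalDomain b y

/-- Finitely many of the local bounds cover a compact set meeting every orbit. They are required
near every point of `V`, including points outside `S`, because `S` need not be closed. -/
theorem exists_bound_of_periodic [FiniteDimensional ℂ V] (Γ : Submodule ℤ V) [DiscreteTopology Γ]
    [IsZLattice ℝ Γ] {S : Set V} {φ : V → ℝ} (hS : ∀ y ∈ S, ∀ γ ∈ Γ, y + γ ∈ S)
    (hφ : ∀ y ∈ S, ∀ γ ∈ Γ, φ (y + γ) = φ y)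
    (hloc : ∀ z, ∃ C, ∀ᶠ y in 𝓝 z, y ∈ S → φ y ≤ C) : ∃ C, ∀ y ∈ S, φ y ≤ C := by
  obtain ⟨K, hK, hKΓ⟩ := exists_compact_translate Γ
  have : ∃ C, ∀ y ∈ K, y ∈ S → φ y ≤ C := by
    refine hK.induction_on (p := fun T => ∃ C, ∀ y ∈ T, y ∈ S → φ y ≤ C) ⟨0, by simp⟩ ?_ ?_ ?_
    · rintro s t hst ⟨C, hC⟩
      exact ⟨C, fun y hy => hC y (hst hy)⟩
    · rintro s t ⟨C, hC⟩ ⟨D, hD⟩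
      refine ⟨max C D, ?_⟩
      rintro y (hy | hy) hyS
      · exact (hC y hy hyS).trans (le_max_left _ _)
      · exact (hD y hy hyS).trans (le_max_right _ _)
    · intro x _
      obtain ⟨C, hC⟩ := hloc x
      exact ⟨_, mem_nhdsWithin_of_mem_nhds hC, C, fun y hy => hy⟩
  obtain ⟨C, hC⟩ := this
  refine ⟨C, fun y hy => ?_⟩
  obtain ⟨γ, hγ, hK⟩ := hKΓ y
  rw [← hφ y hy γ hγ]
  exact hC _ hK (hS y hy γ hγ)

/-! ### The preimage of the hypertorus as a family of parallel hyperplanes. -/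

section Divisor

/-- The image of a lattice under a linear form. -/
def imageLattice (Γ : Submodule ℤ V) (ℓ : V →L[ℂ] ℂ) : Submodule ℤ ℂ :=
  Γ.map ((ℓ : V →ₗ[ℂ] ℂ).restrictScalars ℤ)

/-- The union of the `Γ`-translates of the affine hyperplane `ℓ = ℓ(z₀)`. -/
def hyperplanes (Γ : Submodule ℤ V) (ℓ : V →L[ℂ] ℂ) (z₀ : V) : Set V :=
  {y | ℓ (y - z₀) ∈ imageLattice Γ ℓ}

variable {Γ : Submodule ℤ V} {ℓ : V →L[ℂ] ℂ} {z₀ v : V}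

theorem mem_imageLattice {c : ℂ} : c ∈ imageLattice Γ ℓ ↔ ∃ γ ∈ Γ, ℓ γ = c := by
  simp [imageLattice]

theorem mem_hyperplanes {y : V} : y ∈ hyperplanes Γ ℓ z₀ ↔ ℓ (y - z₀) ∈ imageLattice Γ ℓ :=
  Iff.rfl

theorem add_mem_hyperplanes {y γ : V} (hγ : γ ∈ Γ) :
    y + γ ∈ hyperplanes Γ ℓ z₀ ↔ y ∈ hyperplanes Γ ℓ z₀ := by
  rw [mem_hyperplanes, mem_hyperplanes, add_sub_right_comm, map_add]
  exact (imageLattice Γ ℓ).add_mem_iff_left (mem_imageLattice.2 ⟨γ, hγ, rfl⟩)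

theorem isClosed_hyperplanes [DiscreteTopology (imageLattice Γ ℓ)] :
    IsClosed (hyperplanes Γ ℓ z₀) := by
  have h : IsClosed (imageLattice Γ ℓ : Set ℂ) :=
    @AddSubgroup.isClosed_of_discrete _ _ _ _ _ (imageLattice Γ ℓ).toAddSubgroup _
  exact h.preimage (by fun_prop : Continuous fun y : V => ℓ (y - z₀))

/-- Since `0` is isolated in `ℓ(Γ)`, only one hyperplane of the family comes close to `z`. -/
theorem eventually_mem_hyperplanes_iff [DiscreteTopology (imageLattice Γ ℓ)] {z : V}
    (hz : z ∈ hyperplanes Γ ℓ z₀) :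
    ∀ᶠ y in 𝓝 z, y ∈ hyperplanes Γ ℓ z₀ ↔ ℓ (y - z) = 0 := by
  have h0 : ∀ᶠ c in 𝓝 (0 : ℂ), c ∈ imageLattice Γ ℓ → c = 0 := by
    have h : ({0} : Set (imageLattice Γ ℓ)) ∈ 𝓝 (0 : imageLattice Γ ℓ) :=
      (isOpen_discrete _).mem_nhds rfl
    rw [mem_nhds_subtype] at h
    obtain ⟨u, hu, hsub⟩ := h
    filter_upwards [hu] with c hc hcL
    have : (⟨c, hcL⟩ : imageLattice Γ ℓ) ∈ ({0} : Set (imageLattice Γ ℓ)) := hsub hc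
    exact congrArg Subtype.val this
  have hcont : Tendsto (fun y : V => ℓ (y - z)) (𝓝 z) (𝓝 0) := by
    have : Continuous fun y : V => ℓ (y - z) := by fun_prop
    simpa using this.tendsto z
  filter_upwards [hcont.eventually h0] with y hy
  have e : ℓ (y - z₀) = ℓ (y - z) + ℓ (z - z₀) := by rw [← map_add, sub_add_sub_cancel]
  rw [mem_hyperplanes, e, (imageLattice Γ ℓ).add_mem_iff_left hz]
  exact ⟨hy, fun h => h ▸ (imageLattice Γ ℓ).zero_mem⟩

end Divisor

/-! ### Residues along a transversal complex line. -/

section Residue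

variable {U : Type*} [NormedAddCommGroup U] [NormedSpace ℂ U]

/-- `r` is the residue at `z` of the restriction of `f` to the complex line through `z` in the
direction `v`. -/
def HasLineResidue (v : V) (f : V → U) (z : V) (r : U) : Prop :=
  Tendsto (fun u : ℂ => u • f (z + u • v)) (𝓝[≠] 0) (𝓝 r)

variable {Γ : Submodule ℤ V} {ℓ : V →L[ℂ] ℂ} {z₀ v z : V} {f : V → U} {h : V → U}

theorem HasLineResidue.unique {r r' : U} (hr : HasLineResidue v f z r)
    (hr' : HasLineResidue v f z r') : r = r' :=
  tendsto_nhds_unique hr hr'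

/-- A polar form at `z` serves nearby points `y` of the same hyperplane too: there `ℓ(y + u v - z) =
u`, so multiplying by `u` leaves the numerator. Residues are thus locally given by an analytic
function. -/
theorem IsPolarForm.eventually_hasLineResidue [CompleteSpace U] (hv : ℓ v = 1)
    (hp : IsPolarForm (hyperplanes Γ ℓ z₀) f z ℓ h) :
    ∀ᶠ y in 𝓝 z, y ∈ hyperplanes Γ ℓ z₀ → HasLineResidue v f y (h y) := by
  obtain ⟨-, hh, hZ, hf⟩ := hp
  filter_upwards [hh.eventually_analyticAt, hZ, hZ.eventually_nhds, hf.eventually_nhds]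
    with y hy hyZ hyZ' hyf hymem
  have hy0 : ℓ (y - z) = 0 := hyZ.1 hymem
  have hc : Tendsto (fun u : ℂ => y + u • v) (𝓝[≠] 0) (𝓝 y) := by
    have : Continuous fun u : ℂ => y + u • v := by fun_prop
    have := (this.tendsto 0).mono_left (nhdsWithin_le_nhds (s := {0}ᶜ))
    simpa using this
  refine (hy.continuousAt.tendsto.comp hc).congr' ?_
  filter_upwards [hc.eventually hyZ', hc.eventually hyf, self_mem_nhdsWithin] with u hu1 hu2 hu
  have hu' : u ≠ 0 := hu
  have e : ℓ (y + u • v - z) = u := by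
    rw [add_sub_right_comm, map_add, hy0, map_smul, hv]
    simp
  rw [e] at hu1 hu2
  rw [hu2 fun hmem => hu' (hu1.1 hmem), smul_inv_smul₀ hu']
  rfl

theorem IsPolarForm.hasLineResidue [CompleteSpace U] (hv : ℓ v = 1) (hz : z ∈ hyperplanes Γ ℓ z₀)
    (hp : IsPolarForm (hyperplanes Γ ℓ z₀) f z ℓ h) : HasLineResidue v f z (h z) :=
  (hp.eventually_hasLineResidue hv).self_of_nhds hz

/-- Testing the local condition at `z + u • p` for one small `u ≠ 0` shows `ker ℓ ⊆ ker ℓ'`. -/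
theorem eq_smul_of_eventually_iff (hv : ℓ v = 1) {ℓ' : V →L[ℂ] ℂ} (hℓ' : ℓ' ≠ 0)
    (he : ∀ᶠ y in 𝓝 z, ℓ' (y - z) = 0 ↔ ℓ (y - z) = 0) : ℓ' v ≠ 0 ∧ ℓ' = ℓ' v • ℓ := by
  have hker : ∀ p, ℓ p = 0 → ℓ' p = 0 := by
    intro p hp
    have hc : Tendsto (fun u : ℂ => z + u • p) (𝓝[≠] 0) (𝓝 z) := by
      have : Continuous fun u : ℂ => z + u • p := by fun_prop
      have := (this.tendsto 0).mono_left (nhdsWithin_le_nhds (s := {0}ᶜ))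
      simpa using this
    obtain ⟨u, hu, hu0⟩ := ((hc.eventually he).and self_mem_nhdsWithin).exists
    have hu' : u ≠ 0 := hu0
    simpa [hp, hu'] using hu
  have e : ℓ' = ℓ' v • ℓ := by
    ext p
    have := hker (p - ℓ p • v) (by simp [hv])
    rw [map_sub, map_smul, sub_eq_zero] at this
    simp [this, mul_comm]
  refine ⟨fun h0 => hℓ' ?_, e⟩
  ext p
  rw [e, h0]
  simp

/-- Simple poles and residues are defined with an arbitrary local equation `ℓ'`; this passes to the
fixed `ℓ`, rescaling the numerator by `(ℓ' v)⁻¹`. -/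
theorem IsPolarForm.normalize [DiscreteTopology (imageLattice Γ ℓ)] (hv : ℓ v = 1)
    (hz : z ∈ hyperplanes Γ ℓ z₀) {ℓ' : V →L[ℂ] ℂ}
    (hp : IsPolarForm (hyperplanes Γ ℓ z₀) f z ℓ' h) :
    ℓ' v ≠ 0 ∧ ℓ' = ℓ' v • ℓ ∧
      IsPolarForm (hyperplanes Γ ℓ z₀) f z ℓ (fun y => (ℓ' v)⁻¹ • h y) := by
  obtain ⟨h0, hh, hZ, hf⟩ := hp
  have hZ' := eventually_mem_hyperplanes_iff hz
  obtain ⟨hne, e⟩ := eq_smul_of_eventually_iff (z := z) hv h0 (by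
    filter_upwards [hZ, hZ'] with y hy hy'
    rw [← hy, ← hy'])
  refine ⟨hne, e, fun h => by simp [h] at hv, hh.const_smul, hZ', ?_⟩
  filter_upwards [hf] with y hy hyZ
  rw [hy hyZ, e, smul_smul]
  simp [hv, mul_comm]

theorem IsPolarForm.sub {f' h' : V → U} {Z : Set V} (hp : IsPolarForm Z f z ℓ h)
    (hp' : IsPolarForm Z f' z ℓ h') :
    IsPolarForm Z (fun y => f y - f' y) z ℓ (fun y => h y - h' y) := by
  refine ⟨hp.1, hp.2.1.sub hp'.2.1, hp.2.2.1, ?_⟩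
  filter_upwards [hp.2.2.2, hp'.2.2.2] with y hy hy' hyZ
  rw [hy hyZ, hy' hyZ, smul_sub]

end Residue

/-! ### Uniqueness of quasi-periodic functions with given residues. -/

section Rigidity

variable {U : Type*} [NormedAddCommGroup U] [NormedSpace ℂ U]
variable {Γ : Submodule ℤ V} {ℓ : V →L[ℂ] ℂ} {z₀ v : V} {F : V → U} {χ : ℂ → ℂ}

/-- The numerator vanishes on the hyperplane and is locally Lipschitz. Comparing `y` with its
projection `y - ℓ(y - z) • v` gives `‖h y‖ ≤ K ‖v‖ ‖ℓ(y - z)‖`, which bounds the quotient without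
any extension theorem in several variables. -/
theorem eventually_norm_le_of_isPolarForm [FiniteDimensional ℂ V] [CompleteSpace U] {h : V → U}
    {z : V} (hv : ℓ v = 1)
    (hp : IsPolarForm (hyperplanes Γ ℓ z₀) F z ℓ h)
    (hr : ∀ y ∈ hyperplanes Γ ℓ z₀, HasLineResidue v F y 0) :
    ∃ C, ∀ᶠ y in 𝓝 z, y ∉ hyperplanes Γ ℓ z₀ → ‖F y‖ ≤ C := by
  have hres := hp.eventually_hasLineResidue hv
  obtain ⟨-, hh, hZ, hf⟩ := hp
  have hh0 : ∀ᶠ y in 𝓝 z, ℓ (y - z) = 0 → h y = 0 := by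
    filter_upwards [hres, hZ] with y hy hyZ hy0
    exact (hy (hyZ.2 hy0)).unique (hr y (hyZ.2 hy0))
  obtain ⟨K, t, ht, hK⟩ := (hh.contDiffAt (n := 1)).exists_lipschitzOnWith
  have hc : Tendsto (fun y : V => y - ℓ (y - z) • v) (𝓝 z) (𝓝 z) := by
    have : Continuous fun y : V => y - ℓ (y - z) • v := by fun_prop
    simpa using this.tendsto z
  refine ⟨K * ‖v‖, ?_⟩
  filter_upwards [ht, hc.eventually ht, hc.eventually hh0, hf, hZ] with y hy hy' hy0 hyf hyZ hmem
  have h0 : h (y - ℓ (y - z) • v) = 0 := by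
    refine hy0 ?_
    rw [sub_right_comm, map_sub, map_smul, hv]
    simp
  have hb := hK.norm_sub_le hy hy'
  rw [h0, sub_zero, sub_sub_cancel, norm_smul] at hb
  have hne : 0 < ‖ℓ (y - z)‖ := norm_pos_iff.2 fun h => hmem (hyZ.2 h)
  rw [hyf hmem, norm_smul, norm_inv, inv_mul_le_iff₀ hne]
  linarith

/-- A quasi-periodic function with a nontrivial unitary multiplier, holomorphic away from the
hyperplanes, with vanishing residues of its at most simple poles, is zero. -/
theorem eq_zero_of_residue_eq_zero [FiniteDimensional ℂ V] [CompleteSpace U]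
    [DiscreteTopology Γ] [IsZLattice ℝ Γ] [DiscreteTopology (imageLattice Γ ℓ)]
    (hv : ℓ v = 1) (hχ : ∀ u, ‖χ u‖ = 1) (hnt : ∃ γ ∈ Γ, χ (ℓ γ) ≠ 1)
    (hF : AnalyticOnNhd ℂ F (hyperplanes Γ ℓ z₀)ᶜ)
    (hq : ∀ y ∉ hyperplanes Γ ℓ z₀, ∀ γ ∈ Γ, F (y + γ) = χ (ℓ γ) • F y)
    (hp : ∀ z ∈ hyperplanes Γ ℓ z₀, ∃ h, IsPolarForm (hyperplanes Γ ℓ z₀) F z ℓ h)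
    (hr : ∀ z ∈ hyperplanes Γ ℓ z₀, HasLineResidue v F z 0) :
    ∀ y ∉ hyperplanes Γ ℓ z₀, F y = 0 := by
  obtain ⟨C, hC⟩ : ∃ C, ∀ y ∈ (hyperplanes Γ ℓ z₀)ᶜ, ‖F y‖ ≤ C := by
    refine exists_bound_of_periodic Γ (φ := fun y => ‖F y‖) (fun y hy γ hγ => ?_)
      (fun y hy γ hγ => ?_) (fun z => ?_)
    · exact fun h => hy ((add_mem_hyperplanes hγ).1 h)
    · rw [hq y hy γ hγ, norm_smul, hχ, one_mul]
    · by_cases hz : z ∈ hyperplanes Γ ℓ z₀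
      · obtain ⟨h, hh⟩ := hp z hz
        exact eventually_norm_le_of_isPolarForm hv hh hr
      · refine ⟨‖F z‖ + 1, ?_⟩
        filter_upwards [(hF z hz).continuousAt.norm.eventually_lt_const (lt_add_one _)] with y hy _
        exact hy.le
  have hconst : ∀ a ∉ hyperplanes Γ ℓ z₀, ∀ b ∉ hyperplanes Γ ℓ z₀, F a = F b := by
    intro a ha b hb
    have hc : Continuous fun u : ℂ => a + u • (b - a) := by fun_prop
    have key := apply_eq_apply_of_bounded_off_discrete (g := fun u : ℂ => F (a + u • (b - a)))
      (S := {u : ℂ | a + u • (b - a) ∈ hyperplanes Γ ℓ z₀}) (C := C) (u := 0) (w := 1)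
      (fun u => ?_) (fun u hu => ?_) (fun u hu => hC _ hu) (by simpa using ha) (by simpa using hb)
    · simpa using key
    · by_cases hu : a + u • (b - a) ∈ hyperplanes Γ ℓ z₀
      · have h1 := (hc.tendsto u).eventually (eventually_mem_hyperplanes_iff hu)
        filter_upwards [nhdsWithin_le_nhds h1, self_mem_nhdsWithin] with w hw hwu hwS
        have hwu' : w - u ≠ 0 := sub_ne_zero.2 hwu
        have h2 := hw.1 hwS
        rw [add_sub_add_left_eq_sub, ← sub_smul, map_smul, smul_eq_mul, mul_eq_zero] at h2
        -- A second intersection this close forces the line to be parallel to the hyperplanes, and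
        -- then `a` would lie on one of them.
        have h3 := h2.resolve_left hwu'
        refine ha ?_
        rw [mem_hyperplanes] at hu ⊢
        rwa [add_sub_right_comm, map_add, map_smul, h3, smul_zero, add_zero] at hu
      · exact nhdsWithin_le_nhds
          ((hc.tendsto u).eventually (isClosed_hyperplanes.isOpen_compl.mem_nhds hu))
    · have h1 : DifferentiableAt ℂ F (a + u • (b - a)) := (hF _ hu).differentiableAt
      exact h1.comp u (by fun_prop : DifferentiableAt ℂ (fun u : ℂ => a + u • (b - a)) u)
  intro y hy
  -- The constant value is fixed by multiplication by `χ(ℓ γ) ≠ 1`.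
  obtain ⟨γ, hγ, hne⟩ := hnt
  have h1 := hq y hy γ hγ
  rw [← hconst y hy (y + γ) fun h => hy ((add_mem_hyperplanes hγ).1 h)] at h1
  have h2 : (1 - χ (ℓ γ)) • F y = 0 := by
    rw [sub_smul, one_smul, ← h1, sub_self]
  exact (smul_eq_zero.1 h2).resolve_left (sub_ne_zero.2 hne.symm)

/-- Quasi-periodic functions with at most simple poles are determined by their residues. -/
theorem eq_of_residue_eq [FiniteDimensional ℂ V] [CompleteSpace U]
    [DiscreteTopology Γ] [IsZLattice ℝ Γ] [DiscreteTopology (imageLattice Γ ℓ)] {G : V → U}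
    (hv : ℓ v = 1) (hχ : ∀ u, ‖χ u‖ = 1) (hnt : ∃ γ ∈ Γ, χ (ℓ γ) ≠ 1)
    (hF : AnalyticOnNhd ℂ F (hyperplanes Γ ℓ z₀)ᶜ) (hG : AnalyticOnNhd ℂ G (hyperplanes Γ ℓ z₀)ᶜ)
    (hFq : ∀ y ∉ hyperplanes Γ ℓ z₀, ∀ γ ∈ Γ, F (y + γ) = χ (ℓ γ) • F y)
    (hGq : ∀ y ∉ hyperplanes Γ ℓ z₀, ∀ γ ∈ Γ, G (y + γ) = χ (ℓ γ) • G y)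
    (hp : ∀ z ∈ hyperplanes Γ ℓ z₀, ∃ h h', IsPolarForm (hyperplanes Γ ℓ z₀) F z ℓ h ∧
      IsPolarForm (hyperplanes Γ ℓ z₀) G z ℓ h' ∧ h z = h' z) :
    ∀ y ∉ hyperplanes Γ ℓ z₀, F y = G y := by
  intro y hy
  refine sub_eq_zero.1 (eq_zero_of_residue_eq_zero (F := fun y => F y - G y) hv hχ hnt
    (hF.sub hG) (fun y hy γ hγ => ?_) (fun z hz => ?_) (fun z hz => ?_) y hy)
  · rw [hFq y hy γ hγ, hGq y hy γ hγ, smul_sub]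
  · obtain ⟨h, h', hh, hh', -⟩ := hp z hz
    exact ⟨_, hh.sub hh'⟩
  · obtain ⟨h, h', hh, hh', e⟩ := hp z hz
    have := (hh.sub hh').hasLineResidue hv hz
    rwa [e, sub_self] at this

/-- The residue of a quasi-periodic function with unitary multiplier is determined by its value at
one point. -/
theorem residue_eq [FiniteDimensional ℂ V] [CompleteSpace U] [DiscreteTopology Γ] [IsZLattice ℝ Γ]
    [DiscreteTopology (imageLattice Γ ℓ)]
    (hv : ℓ v = 1) (hχ : ∀ u, ‖χ u‖ = 1)
    (hq : ∀ y ∉ hyperplanes Γ ℓ z₀, ∀ γ ∈ Γ, F (y + γ) = χ (ℓ γ) • F y)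
    (hp : ∀ z ∈ hyperplanes Γ ℓ z₀, ∃ h, IsPolarForm (hyperplanes Γ ℓ z₀) F z ℓ h) :
    ∃ c : U, ∀ z ∈ hyperplanes Γ ℓ z₀, HasLineResidue v F z (χ (ℓ (z - z₀)) • c) := by
  have hex : ∀ z : V, ∃ r, z ∈ hyperplanes Γ ℓ z₀ → HasLineResidue v F z r := by
    intro z
    by_cases hz : z ∈ hyperplanes Γ ℓ z₀
    · obtain ⟨h, hh⟩ := hp z hz
      exact ⟨h z, fun _ => hh.hasLineResidue hv hz⟩
    · exact ⟨0, fun h => absurd h hz⟩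
  choose R hR using hex
  have hRq : ∀ z ∈ hyperplanes Γ ℓ z₀, ∀ γ ∈ Γ, R (z + γ) = χ (ℓ γ) • R z := by
    intro z hz γ hγ
    refine (hR _ ((add_mem_hyperplanes hγ).2 hz)).unique ?_
    refine ((hR z hz).const_smul (χ (ℓ γ))).congr' ?_
    obtain ⟨h, -, -, hZ, -⟩ := hp z hz
    have hc : Tendsto (fun u : ℂ => z + u • v) (𝓝[≠] 0) (𝓝 z) := by
      have : Continuous fun u : ℂ => z + u • v := by fun_prop
      have := (this.tendsto 0).mono_left (nhdsWithin_le_nhds (s := {0}ᶜ))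
      simpa using this
    filter_upwards [hc.eventually hZ, self_mem_nhdsWithin] with u hu hu0
    have hu' : u ≠ 0 := hu0
    have hn : z + u • v ∉ hyperplanes Γ ℓ z₀ := fun hm => hu' (by simpa [hv] using hu.1 hm)
    rw [add_right_comm, hq _ hn γ hγ, smul_comm]
  have hloc : ∀ z ∈ hyperplanes Γ ℓ z₀, ∃ h : V → U, AnalyticAt ℂ h z ∧
      ∀ᶠ y in 𝓝 z, y ∈ hyperplanes Γ ℓ z₀ → R y = h y := by
    intro z hz
    obtain ⟨h, hh⟩ := hp z hz
    refine ⟨h, hh.2.1, ?_⟩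
    filter_upwards [hh.eventually_hasLineResidue hv] with y hy hyZ
    exact (hR y hyZ).unique (hy hyZ)
  have hker : ∀ p : LinearMap.ker (ℓ : V →ₗ[ℂ] ℂ), z₀ + (p : V) ∈ hyperplanes Γ ℓ z₀ := by
    intro p
    have hp0 : ℓ (p : V) = 0 := p.2
    rw [mem_hyperplanes, add_sub_cancel_left, hp0]
    exact Submodule.zero_mem _
  obtain ⟨C, hC⟩ : ∃ C, ∀ y ∈ hyperplanes Γ ℓ z₀, ‖R y‖ ≤ C := by
    refine exists_bound_of_periodic Γ (φ := fun y => ‖R y‖)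
      (fun y hy γ hγ => (add_mem_hyperplanes hγ).2 hy) (fun y hy γ hγ => ?_) (fun z => ?_)
    · rw [hRq y hy γ hγ, norm_smul, hχ, one_mul]
    · by_cases hz : z ∈ hyperplanes Γ ℓ z₀
      · obtain ⟨h, hh, he⟩ := hloc z hz
        refine ⟨‖h z‖ + 1, ?_⟩
        filter_upwards [hh.continuousAt.norm.eventually_lt_const (lt_add_one _), he] with y hy hy' hm
        rw [hy' hm]
        exact hy.le
      · refine ⟨0, ?_⟩
        filter_upwards [isClosed_hyperplanes.isOpen_compl.mem_nhds hz] with y hy hy'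
        exact absurd hy' hy
  have hd : Differentiable ℂ fun p : LinearMap.ker (ℓ : V →ₗ[ℂ] ℂ) => R (z₀ + (p : V)) := by
    intro p
    obtain ⟨h, hh, he⟩ := hloc _ (hker p)
    have hdi : DifferentiableAt ℂ
        (fun p : LinearMap.ker (ℓ : V →ₗ[ℂ] ℂ) => z₀ + (p : V)) p :=
      ((LinearMap.ker (ℓ : V →ₗ[ℂ] ℂ)).subtypeL.differentiableAt).const_add z₀
    refine (hh.differentiableAt.comp p hdi).congr_of_eventuallyEq ?_
    filter_upwards [hdi.continuousAt.eventually he] with p' hp'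
    exact hp' (hker p')
  have hb : Bornology.IsBounded
      (range fun p : LinearMap.ker (ℓ : V →ₗ[ℂ] ℂ) => R (z₀ + (p : V))) := by
    refine (Metric.isBounded_closedBall (x := (0 : U)) (r := C)).subset ?_
    rintro _ ⟨p, rfl⟩
    rw [mem_closedBall_zero_iff]
    exact hC _ (hker p)
  refine ⟨R z₀, fun z hz => ?_⟩
  -- Write `z = z₀ + p + γ` with `p ∈ ker ℓ`: Liouville on `ker ℓ` removes `p`, and
  -- quasi-periodicity accounts for `γ`.
  obtain ⟨γ, hγ, hγz⟩ := mem_imageLattice.1 hz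
  have hpker : ℓ (z - z₀ - γ) = 0 := by rw [map_sub, hγz, sub_self]
  have h1 := hd.apply_eq_apply_of_bounded hb ⟨z - z₀ - γ, hpker⟩ 0
  have h2 := hRq _ (hker ⟨z - z₀ - γ, hpker⟩) γ hγ
  simp only [Submodule.coe_zero, add_zero] at h1
  rw [h1, hγz, show z₀ + (z - z₀ - γ) + γ = z by abel] at h2
  rw [← h2]
  exact hR z hz

end Rigidity

end EllipticDunkl
end

noncomputable section

open Set Filter Topology

namespace EllipticDunkl

/-! ### Topology of the covering map. -/

section Projection

variable {V : Type*} [NormedAddCommGroup V] {Γ : Submodule ℤ V}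

theorem proj_add (z : V) {γ : V} (hγ : γ ∈ Γ) : proj Γ (z + γ) = proj Γ z := by
  refine (Submodule.Quotient.eq Γ).2 ?_
  rwa [add_sub_cancel_left]

theorem proj_eq_proj_iff {z w : V} : proj Γ z = proj Γ w ↔ z - w ∈ Γ :=
  Submodule.Quotient.eq Γ

theorem continuous_proj : Continuous (proj Γ) := continuous_quot_mk

theorem isClosed_of_preimage_proj {S : Set (V ⧸ Γ)} (hS : IsClosed (proj Γ ⁻¹' S)) : IsClosed S :=
  isQuotientMap_quot_mk.isClosed_preimage.1 hS

theorem isClosed_of_subset_discrete [DiscreteTopology Γ] {A : Set V} (hA : A ⊆ Γ) :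
    IsClosed A := by
  have h : IsClosed (Γ : Set V) := @AddSubgroup.isClosed_of_discrete _ _ _ _ _ Γ.toAddSubgroup _
  have := h.isClosedEmbedding_subtypeVal.isClosedMap _
    (isClosed_discrete ((Subtype.val : Γ → V) ⁻¹' A))
  have e : (Subtype.val : Γ → V) '' ((Subtype.val : Γ → V) ⁻¹' A) = A :=
    image_preimage_eq_of_subset fun x hx => ⟨⟨x, hA hx⟩, rfl⟩
  exact e ▸ this

end Projection

variable {V : Type*} [NormedAddCommGroup V] [NormedSpace ℂ V] {Γ : Submodule ℤ V}

/-! ### Sections of bundles as quasi-periodic functions. -/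

section Sections

variable {χ : AutFactor Γ} {U : Type*} [NormedAddCommGroup U] [NormedSpace ℂ U]
variable {H : Set (V ⧸ Γ)}

theorem Bundle.mk_add (z : V) (γ : Γ) (u : U) :
    Bundle.mk χ (z + γ) ((χ.toFun γ z : ℂ) • u) = Bundle.mk χ z u :=
  (Quotient.sound ⟨γ, rfl⟩ : Bundle.mk χ z u = _).symm

/-- `Γ` acts freely on `V`, so no two vectors over the same `z` are identified. -/
theorem Bundle.mk_injective (z : V) : Function.Injective (Bundle.mk χ (U := U) z) := by
  intro u u' h
  obtain ⟨γ, hγ⟩ := Quotient.exact h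
  rw [Prod.mk.injEq] at hγ
  obtain ⟨h1, h2⟩ := hγ
  have h0 : γ = 0 := by
    ext
    simpa using h1
  rw [h2, h0, χ.map_zero]
  simp

theorem SectionOff.IsLift.apply_add {s : SectionOff χ U H} {f : V → U} (hf : s.IsLift f) {z : V}
    (hz : proj Γ z ∉ H) (γ : Γ) : f (z + γ) = (χ.toFun γ z : ℂ) • f z := by
  refine Bundle.mk_injective (χ := χ) (z + γ) ?_
  have e : proj Γ (z + γ) = proj Γ z := proj_add z γ.2
  have hz' : proj Γ (z + γ) ∉ H := by rwa [e]
  rw [Bundle.mk_add, ← hf z hz, ← hf (z + γ) hz']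
  simp only [e]

theorem SectionOff.IsLift.eq {s : SectionOff χ U H} {f f' : V → U} (hf : s.IsLift f)
    (hf' : s.IsLift f') {z : V} (hz : proj Γ z ∉ H) : f z = f' z :=
  Bundle.mk_injective z ((hf z hz).symm.trans (hf' z hz))

theorem SectionOff.ext_of_isLift {s t : SectionOff χ U H} {f f' : V → U} (hf : s.IsLift f)
    (hf' : t.IsLift f') (h : ∀ z, proj Γ z ∉ H → f z = f' z) : s = t := by
  have : s.toFun = t.toFun := by
    funext ⟨x, hx⟩
    obtain ⟨z, rfl⟩ := Submodule.Quotient.mk_surjective Γ x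
    exact (hf z hx).trans ((congrArg _ (h z hx)).trans (hf' z hx).symm)
  cases s
  cases t
  congr

theorem exists_bundle_map_of_quasiperiodic {S : Set (V ⧸ Γ)} (f : V → U)
    (hf : ∀ z, proj Γ z ∈ S → ∀ γ : Γ, f (z + γ) = (χ.toFun γ z : ℂ) • f z) :
    ∃ r : S → Bundle χ U, ∀ (z : V) (hz : proj Γ z ∈ S), r ⟨proj Γ z, hz⟩ = Bundle.mk χ z (f z) := by
  refine ⟨fun x => Bundle.mk χ (Quotient.out x.1) (f (Quotient.out x.1)), fun z hz => ?_⟩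
  have h : proj Γ (Quotient.out (proj Γ z)) = proj Γ z := Quotient.out_eq _
  have hm := proj_eq_proj_iff.1 h
  have e : Quotient.out (proj Γ z) = z + (⟨_, hm⟩ : Γ) := by simp
  simp only
  rw [e, hf z hz, Bundle.mk_add]

theorem exists_section_of_quasiperiodic (f : V → U)
    (hf : ∀ z, proj Γ z ∉ H → ∀ γ : Γ, f (z + γ) = (χ.toFun γ z : ℂ) • f z) :
    ∃ s : SectionOff χ U H, s.IsLift f := by
  obtain ⟨r, hr⟩ := exists_bundle_map_of_quasiperiodic (S := Hᶜ) f hf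
  refine ⟨⟨r, ?_⟩, hr⟩
  rintro ⟨x, hx⟩
  obtain ⟨z, rfl⟩ := Submodule.Quotient.mk_surjective Γ x
  exact (congrArg Bundle.base (hr z hx)).trans rfl

end Sections

/-! ### The character of the twisted bundle and its canonical trivialization. -/

section Twist

/-- The character `γ ↦ exp(2πi ω(β, γ))` extended to all of `V` and restricted to the line `ℂ v`. -/
def lineChar (β : AntiDual V) (v : V) (u : ℂ) : ℂ :=
  Complex.exp (2 * Real.pi * Complex.I * (omega β (u • v) : ℂ))

theorem norm_lineChar (β : AntiDual V) (v : V) (u : ℂ) : ‖lineChar β v u‖ = 1 := by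
  rw [lineChar, show (2 * Real.pi * Complex.I * (omega β (u • v) : ℂ) : ℂ) =
    ((2 * Real.pi * omega β (u • v) : ℝ) : ℂ) * Complex.I by push_cast; ring]
  exact Complex.norm_exp_ofReal_mul_I _

theorem lineChar_add (β : AntiDual V) (v : V) (a b : ℂ) :
    lineChar β v (a + b) = lineChar β v a * lineChar β v b := by
  rw [lineChar, lineChar, lineChar, ← Complex.exp_add]
  congr 1
  simp only [omega, add_smul, map_add, Complex.add_im]
  push_cast
  ring

variable {ℓ : V →L[ℂ] ℂ} {v : V} {α : AntiDual V}

/-- `β` kills `z - ℓ z • v`, so the character of `V` attached to `β` descends to `ℂ` through `ℓ`. -/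
theorem lineChar_apply (hv : ℓ v = 1) {β : AntiDual V} (hβ : ∀ p, ℓ p = 0 → β p = 0) (z : V) :
    lineChar β v (ℓ z) = Complex.exp (2 * Real.pi * Complex.I * (omega β z : ℂ)) := by
  have h : β (z - ℓ z • v) = 0 := hβ _ (by simp [hv])
  rw [map_sub, sub_eq_zero] at h
  rw [lineChar, omega, omega, h]

/-- The difference `α - gα`, which describes the line bundle `(𝓛^g)^* ⊗ 𝓛`. -/
def twistForm (α : AntiDual V) (g : V ≃ₗ[ℂ] V) : AntiDual V := α - dualAct g α

theorem twistForm_apply (g : V ≃ₗ[ℂ] V) (z : V) : twistForm α g z = α z - α (g.symm z) := rfl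

theorem twistForm_eq_zero {g : V ≃ₗ[ℂ] V} {p : V} (hp : g p = p) : twistForm α g p = 0 := by
  have : g.symm p = p := by rw [LinearEquiv.symm_apply_eq, hp]
  rw [twistForm_apply, this, sub_self]

theorem twistFactor_apply (g : V ≃ₗ[ℂ] V) (γ : Γ) (z : V) :
    ((twistFactor Γ α g).toFun γ z : ℂ) =
      Complex.exp (2 * Real.pi * Complex.I * (omega (twistForm α g) γ : ℂ)) := by
  simp only [twistFactor, AutFactor.tensor, AutFactor.dual, charFactor, Units.val_mul,
    Units.val_inv_eq_inv_val, Units.val_mk0, ← Complex.exp_neg, ← Complex.exp_add, omega,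
    twistForm_apply, dualAct, LinearMap.comp_apply, Complex.sub_im]
  congr 1
  push_cast
  ring_nf

/-- The value of the canonical trivialization of `(𝓛^g)^* ⊗ 𝓛` over a fixed point of `g`. -/
theorem mk_eq_twistMap_iff (g : latticeAut Γ) {z : V} (hz : (g : V ≃ₗ[ℂ] V).symm z - z ∈ Γ)
    (c : ℂ) : (∀ ξ : ℂ, Bundle.mk (charFactor Γ α) z (c * ξ) = twistMap α g (Bundle.mk _ z ξ)) ↔
      c = Complex.exp (2 * Real.pi * Complex.I * (omega (twistForm α (g : V ≃ₗ[ℂ] V)) z : ℂ)) := by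
  -- Over a fixed point, `g⁻¹ z` is a `Γ`-translate of `z`; moving back to `z` costs the inverse
  -- multiplier, which `e2` identifies with `d`.
  have e1 : ∀ ξ : ℂ, twistMap α g (Bundle.mk _ z ξ) =
      Bundle.mk (charFactor Γ α) (z + (⟨_, hz⟩ : Γ)) ξ := by
    intro ξ
    have : (z + (⟨_, hz⟩ : Γ) : V) = (g : V ≃ₗ[ℂ] V).symm z := by simp
    rw [this]
    rfl
  set d : ℂ := Complex.exp
    (2 * Real.pi * Complex.I * (omega (twistForm α (g : V ≃ₗ[ℂ] V)) z : ℂ)) with hd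
  have e2 : (((charFactor Γ α).toFun ⟨_, hz⟩ z : ℂˣ) : ℂ) * d = 1 := by
    rw [hd, charFactor]
    simp only [Units.val_mk0, ← Complex.exp_add]
    rw [Complex.exp_eq_one_iff]
    refine ⟨0, ?_⟩
    simp only [omega, twistForm_apply, map_sub, Complex.sub_im]
    push_cast
    ring
  have e3 : ∀ x : ℂ, Bundle.mk (charFactor Γ α) (z + (⟨_, hz⟩ : Γ)) x =
      Bundle.mk (charFactor Γ α) z (d * x) := by
    intro x
    rw [← Bundle.mk_add z ⟨_, hz⟩ (d * x), smul_eq_mul, ← mul_assoc, e2, one_mul]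
  constructor
  · intro h
    have := h 1
    rw [e1, e3] at this
    simpa using Bundle.mk_injective z this
  · rintro rfl ξ
    rw [e1, e3]

/-- If the character were trivial on `Γ`, then `ω(α - wα, Γ) ⊆ ℤ`, so `w` would fix the class of `α`
in the dual torus. -/
theorem exists_lineChar_ne_one (hv : ℓ v = 1) {W : Subgroup (latticeAut Γ)}
    (hα : HasTrivialStabilizer W α) {w : W} (hw : w ≠ 1)
    (hfix : ∀ p, ℓ p = 0 → ((w : latticeAut Γ) : V ≃ₗ[ℂ] V) p = p) :
    ∃ γ ∈ Γ, lineChar (twistForm α ((w : latticeAut Γ) : V ≃ₗ[ℂ] V)) v (ℓ γ) ≠ 1 := by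
  by_contra! h
  refine hw (hα w ?_)
  rw [QuotientAddGroup.eq, neg_add_eq_sub]
  intro γ hγ
  have h1 := h γ hγ
  rw [lineChar_apply hv (fun p hp => twistForm_eq_zero (hfix p hp)), Complex.exp_eq_one_iff] at h1
  obtain ⟨n, hn⟩ := h1
  refine ⟨n, ?_⟩
  have h2 : (omega (twistForm α ((w : latticeAut Γ) : V ≃ₗ[ℂ] V)) γ : ℂ) = n := by
    have : (2 * Real.pi * Complex.I : ℂ) ≠ 0 := Complex.two_pi_I_ne_zero
    exact mul_left_cancel₀ this (by rw [hn]; ring)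
  exact_mod_cast h2

end Twist

/-! ### Reflections, their lattices and hypertori. -/

section Geometry

/-- `g - 1` vanishes on a hyperplane and is not zero, so it has rank one. -/
theorem exists_linearForm_of_isReflection [FiniteDimensional ℂ V] {g : V ≃ₗ[ℂ] V} (hg : IsReflection g) :
    ∃ (ℓ : V →L[ℂ] ℂ) (v v₁ : V), ℓ v = 1 ∧ v₁ ≠ 0 ∧ ∀ z, g z - z = ℓ z • v₁ := by
  obtain ⟨hg1, -, P, hP, hfix⟩ := hg
  have hPtop : P ≠ ⊤ := by
    rintro rfl
    rw [finrank_top] at hP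
    omega
  obtain ⟨x, hx⟩ : ∃ x, x ∉ P := by
    by_contra! h
    exact hPtop (Submodule.eq_top_iff'.2 h)
  obtain ⟨φ, hφx, hφP⟩ := Submodule.exists_le_ker_of_notMem hx
  have hker : P = LinearMap.ker φ := by
    refine Submodule.eq_of_le_of_finrank_le hφP ?_
    have h1 := LinearMap.finrank_range_add_finrank_ker φ
    have h2 : 0 < Module.finrank ℂ (LinearMap.range φ) := by
      rw [Module.finrank_pos_iff_exists_ne_zero]
      exact ⟨⟨φ x, x, rfl⟩, fun h => hφx (congrArg Subtype.val h)⟩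
    omega
  set ℓ : V →L[ℂ] ℂ := LinearMap.toContinuousLinearMap φ with hℓ
  have hℓx : ℓ x ≠ 0 := hφx
  set v := (ℓ x)⁻¹ • x with hvdef
  have hv : ℓ v = 1 := by rw [hvdef, map_smul, smul_eq_mul, inv_mul_cancel₀ hℓx]
  have hform : ∀ z, g z - z = ℓ z • (g v - v) := by
    intro z
    have hz : z - ℓ z • v ∈ P := by
      rw [hker, LinearMap.mem_ker]
      change ℓ (z - ℓ z • v) = 0
      rw [map_sub, map_smul, hv]
      simp
    have := hfix _ hz
    rw [map_sub, map_smul] at this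
    rw [smul_sub, sub_eq_sub_iff_sub_eq_sub]
    rw [this]
  refine ⟨ℓ, v, g v - v, hv, fun h => hg1 ?_, hform⟩
  ext z
  have := hform z
  rw [h, smul_zero, sub_eq_zero] at this
  exact this

/-- `g - 1` maps `Γ` into `Γ`, so `c ↦ c • v₁` embeds `ℓ(Γ)` in the discrete group `Γ`. For a
general linear form the image of a lattice need not be discrete. -/
theorem discreteTopology_imageLattice [DiscreteTopology Γ] {g : latticeAut Γ} {ℓ : V →L[ℂ] ℂ}
    {v₁ : V} (hv₁ : v₁ ≠ 0) (hg : ∀ z, (g : V ≃ₗ[ℂ] V) z - z = ℓ z • v₁) :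
    DiscreteTopology (imageLattice Γ ℓ) := by
  have hmem : ∀ c : imageLattice Γ ℓ, (c : ℂ) • v₁ ∈ Γ := by
    rintro ⟨c, hc⟩
    obtain ⟨γ, hγ, rfl⟩ := mem_imageLattice.1 hc
    rw [← hg]
    exact Γ.sub_mem ((g.2 γ).2 hγ) hγ
  refine DiscreteTopology.of_continuous_injective
    (f := fun c : imageLattice Γ ℓ => (⟨(c : ℂ) • v₁, hmem c⟩ : Γ)) (by fun_prop) ?_
  intro c d h
  exact Subtype.ext (smul_left_injective ℂ hv₁ (congrArg Subtype.val h))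

theorem isZLattice_imageLattice [DiscreteTopology Γ] [IsZLattice ℝ Γ] {ℓ : V →L[ℂ] ℂ} {v : V}
    [DiscreteTopology (imageLattice Γ ℓ)] (hv : ℓ v = 1) :
    IsZLattice ℝ (imageLattice Γ ℓ) := by
  refine ⟨?_⟩
  have hspan := IsZLattice.span_top (K := ℝ) (L := Γ)
  have e : (imageLattice Γ ℓ : Set ℂ) = ((ℓ : V →ₗ[ℂ] ℂ).restrictScalars ℝ) '' (Γ : Set V) := rfl
  rw [e, Submodule.span_image, hspan, Submodule.map_top, LinearMap.range_eq_top]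
  intro c
  exact ⟨c • v, by simp [hv]⟩

/-- A reflection hypertorus is the image of an affine hyperplane. -/
theorem proj_mem_connectedComponentIn_iff [DiscreteTopology Γ] {W : Subgroup (latticeAut Γ)} {g : W}
    {ℓ : V →L[ℂ] ℂ} {v₁ : V} (hv₁ : v₁ ≠ 0)
    (hg : ∀ z, ((g : latticeAut Γ) : V ≃ₗ[ℂ] V) z - z = ℓ z • v₁) {z₀ : V}
    (hz₀ : proj Γ z₀ ∈ MulAction.fixedBy (V ⧸ Γ) g) (z : V) :
    proj Γ z ∈ connectedComponentIn (MulAction.fixedBy (V ⧸ Γ) g) (proj Γ z₀) ↔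
      z ∈ hyperplanes Γ ℓ z₀ := by
  have hfix : ∀ z, proj Γ z ∈ MulAction.fixedBy (V ⧸ Γ) g ↔ ℓ z • v₁ ∈ Γ := by
    intro z
    rw [← hg, ← proj_eq_proj_iff]
    rfl
  have hz₀' := (hfix z₀).1 hz₀
  have hΓ : ∀ γ ∈ Γ, ℓ γ • v₁ ∈ Γ := fun γ hγ => by
    rw [← hg]
    exact Γ.sub_mem (((g : latticeAut Γ).2 γ).2 hγ) hγ
  -- The fixed locus is `ℓ z • v₁ ∈ Γ`, and `A` collects the values taken on the hyperplanes through
  -- translates of `z₀`. Both `A` and `Γ \ A` are closed, being subsets of a discrete subgroup, so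
  -- they split the fixed locus into disjoint closed pieces and the component lies in one of them.
  set A : Set V := {y | ∃ c ∈ imageLattice Γ ℓ, y = (ℓ z₀ + c) • v₁} with hA
  have hAΓ : A ⊆ Γ := by
    rintro _ ⟨c, hc, rfl⟩
    obtain ⟨γ, hγ, rfl⟩ := mem_imageLattice.1 hc
    rw [add_smul]
    exact Γ.add_mem hz₀' (hΓ γ hγ)
  have hAmem : ∀ z, ℓ z • v₁ ∈ A ↔ z ∈ hyperplanes Γ ℓ z₀ := by
    intro z
    rw [mem_hyperplanes, map_sub]
    constructor
    · rintro ⟨c, hc, h⟩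
      rw [smul_left_injective ℂ hv₁ h, add_sub_cancel_left]
      exact hc
    · exact fun h => ⟨_, h, by rw [add_sub_cancel]⟩
  have hcont : Continuous fun z => ℓ z • v₁ := by fun_prop
  constructor
  · intro hz
    have hpre := isPreconnected_connectedComponentIn (F := MulAction.fixedBy (V ⧸ Γ) g)
      (x := proj Γ z₀)
    rw [isPreconnected_iff_subset_of_disjoint_closed] at hpre
    have h1 : proj Γ ⁻¹' (proj Γ '' hyperplanes Γ ℓ z₀) = {z | ℓ z • v₁ ∈ A} := by
      ext y
      rw [mem_preimage, mem_ofPred, hAmem]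
      constructor
      · rintro ⟨w, hw, e⟩
        have h := proj_eq_proj_iff.1 e.symm
        rw [← add_sub_cancel w y]
        exact (add_mem_hyperplanes h).2 hw
      · exact fun h => ⟨y, h, rfl⟩
    have h2 : proj Γ ⁻¹' (MulAction.fixedBy (V ⧸ Γ) g \ proj Γ '' hyperplanes Γ ℓ z₀) =
        {z | ℓ z • v₁ ∈ (Γ : Set V) \ A} := by
      rw [preimage_sdiff, h1]
      ext y
      simp [hfix]
    have := hpre (proj Γ '' hyperplanes Γ ℓ z₀)
      (MulAction.fixedBy (V ⧸ Γ) g \ proj Γ '' hyperplanes Γ ℓ z₀)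
      (isClosed_of_preimage_proj (h1 ▸ (isClosed_of_subset_discrete hAΓ).preimage hcont))
      (isClosed_of_preimage_proj
        (h2 ▸ (isClosed_of_subset_discrete sdiff_subset).preimage hcont))
      (fun x hx => by
        by_cases h : x ∈ proj Γ '' hyperplanes Γ ℓ z₀
        · exact Or.inl h
        · exact Or.inr ⟨connectedComponentIn_subset _ _ hx, h⟩)
      (by rw [inter_sdiff_self, inter_empty])
    have hmem₀ : proj Γ z₀ ∈ proj Γ '' hyperplanes Γ ℓ z₀ :=
      ⟨z₀, by rw [mem_hyperplanes, sub_self, map_zero]; exact Submodule.zero_mem _, rfl⟩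
    have hsub := this.resolve_right fun h => (h (mem_connectedComponentIn hz₀)).2 hmem₀
    have hz' : z ∈ proj Γ ⁻¹' (proj Γ '' hyperplanes Γ ℓ z₀) := hsub hz
    rw [h1] at hz'
    exact (hAmem z).1 hz'
  · intro hz
    obtain ⟨γ, hγ, h⟩ := mem_imageLattice.1 hz
    -- Conversely, the image of one affine hyperplane is connected, and `z` has a translate on it.
    set T : Set V := {y | ℓ y = ℓ z₀} with hT
    have hTconv : Convex ℝ T := by
      intro a ha b hb s t _ _ hst
      simp only [hT, mem_ofPred] at ha hb ⊢
      have : ℓ (s • a + t • b) = ((s + t : ℝ) : ℂ) * ℓ z₀ := by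
        rw [← Complex.coe_smul, ← Complex.coe_smul, map_add, map_smul, map_smul, ha, hb]
        push_cast
        simp [add_mul]
      rw [this, hst]
      simp
    have hTpre : IsPreconnected (proj Γ '' T) :=
      hTconv.isPreconnected.image _ continuous_proj.continuousOn
    have hsub : proj Γ '' T ⊆ connectedComponentIn (MulAction.fixedBy (V ⧸ Γ) g) (proj Γ z₀) := by
      refine hTpre.subset_connectedComponentIn ⟨z₀, rfl, rfl⟩ ?_
      rintro _ ⟨y, hy, rfl⟩
      rw [hfix, show ℓ y = ℓ z₀ from hy]
      exact hz₀'
    refine hsub ⟨z - γ, ?_, ?_⟩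
    · change ℓ (z - γ) = ℓ z₀
      rw [map_sub, h, map_sub, sub_sub_cancel]
    · rw [← proj_add (z - γ) hγ, sub_add_cancel]

/-- Along the real line `z₀ + t p` the difference `g z - z` is continuous with values in the
discrete `Γ`, hence constant; comparing `t = 1` with `t = 0` gives `g p = p`. -/
theorem apply_eq_self_of_fixes [FiniteDimensional ℂ V] [DiscreteTopology Γ] {g : latticeAut Γ} {ℓ : V →L[ℂ] ℂ} {z₀ : V}
    (hg : ∀ z ∈ hyperplanes Γ ℓ z₀, (g : V ≃ₗ[ℂ] V) z - z ∈ Γ) {p : V} (hp : ℓ p = 0) :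
    (g : V ≃ₗ[ℂ] V) p = p := by
  have hmem : ∀ t : ℝ, z₀ + t • p ∈ hyperplanes Γ ℓ z₀ := by
    intro t
    rw [mem_hyperplanes, add_sub_cancel_left, ← Complex.coe_smul, map_smul, hp, smul_zero]
    exact Submodule.zero_mem _
  have hgc : Continuous fun z => (g : V ≃ₗ[ℂ] V) z :=
    ((g : V ≃ₗ[ℂ] V) : V →ₗ[ℂ] V).continuous_of_finiteDimensional
  have hc : Continuous fun t : ℝ => (⟨_, hg _ (hmem t)⟩ : Γ) := by
    refine Continuous.subtype_mk ?_ _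
    exact (hgc.comp (by fun_prop)).sub (by fun_prop)
  have h := congrArg Subtype.val (PreconnectedSpace.constant inferInstance hc (x := 1) (y := 0))
  simpa [add_sub_add_comm, sub_eq_zero] using h

end Geometry

end EllipticDunkl
end

noncomputable section

open Set Filter Topology

namespace EllipticDunkl

variable {V : Type*} [NormedAddCommGroup V] [NormedSpace ℂ V] {Γ : Submodule ℤ V}

/-! ### The model function on `V`. -/

section Model

variable {ℓ : V →L[ℂ] ℂ} {v z₀ : V} {χ : ℂ → ℂ}

theorem IsPolarForm.congr {U : Type*} [NormedAddCommGroup U] [NormedSpace ℂ U] {Z : Set V}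
    {f f' h : V → U} {z : V} (hp : IsPolarForm Z f z ℓ h) (hff' : ∀ y ∉ Z, f y = f' y) :
    IsPolarForm Z f' z ℓ h := by
  refine ⟨hp.1, hp.2.1, hp.2.2.1, ?_⟩
  filter_upwards [hp.2.2.2] with y hy hyZ
  rw [← hff' y hyZ, hy hyZ]

theorem analyticOnNhd_smul_const {U : Type*} [NormedAddCommGroup U] [NormedSpace ℂ U] {f : V → ℂ}
    {S : Set V} (hf : AnalyticOnNhd ℂ f S) (u : U) : AnalyticOnNhd ℂ (fun y => f y • u) S :=
  fun y hy => (hf y hy).smul analyticAt_const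

theorem IsPolarForm.smul_right {U : Type*} [NormedAddCommGroup U] [NormedSpace ℂ U] {Z : Set V}
    {f h : V → ℂ} {z : V} (hp : IsPolarForm Z f z ℓ h) (u : U) :
    IsPolarForm Z (fun y => f y • u) z ℓ (fun y => h y • u) := by
  refine ⟨hp.1, hp.2.1.smul analyticAt_const, hp.2.2.1, ?_⟩
  filter_upwards [hp.2.2.2] with y hy hyZ
  rw [hy hyZ, smul_assoc]

/-- A quasi-periodic function with simple poles on the given hyperplanes. -/
theorem exists_quasiperiodic_hyperplanes [DiscreteTopology (imageLattice Γ ℓ)]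
    [IsZLattice ℝ (imageLattice Γ ℓ)] (hv : ℓ v = 1) (hχ : ∀ u, ‖χ u‖ = 1)
    (hadd : ∀ a b, χ (a + b) = χ a * χ b) (hnt : ∃ γ ∈ Γ, χ (ℓ γ) ≠ 1) (z₀ : V) :
    ∃ F : V → ℂ, AnalyticOnNhd ℂ F (hyperplanes Γ ℓ z₀)ᶜ ∧
      (∀ y, ∀ γ ∈ Γ, F (y + γ) = χ (ℓ γ) * F y) ∧
      ∀ z ∈ hyperplanes Γ ℓ z₀, ∃ h, IsPolarForm (hyperplanes Γ ℓ z₀) F z ℓ h ∧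
        h z = χ (ℓ (z - z₀)) := by
  obtain ⟨γ, hγ, hne⟩ := hnt
  obtain ⟨f, h, hf, hh, hfh, hfa⟩ := exists_quasiperiodic (L := imageLattice Γ ℓ) hχ hadd
    ⟨ℓ γ, mem_imageLattice.2 ⟨γ, hγ, rfl⟩, hne⟩
  have hlin : ∀ a y : V, AnalyticAt ℂ (fun y => ℓ (y - a)) y := fun a y =>
    AnalyticAt.fun_comp (g := ℓ) (ℓ.analyticAt _) (analyticAt_id.sub analyticAt_const)
  refine ⟨fun y => f (ℓ (y - z₀)), fun y hy => ?_, fun y γ hγ => ?_, fun z hz => ?_⟩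
  · exact AnalyticAt.fun_comp (g := f) (hfa _ hy) (hlin z₀ y)
  · simp only
    rw [add_sub_right_comm, map_add]
    exact hf _ _ (mem_imageLattice.2 ⟨γ, hγ, rfl⟩)
  -- Quasi-periodicity moves the pole from `ℓ(z - z₀) ∈ ℓ(Γ)` to `0`, where `f u = u⁻¹ + h u` has
  -- numerator `1 + u h(u)`.
  · refine ⟨fun y => χ (ℓ (z - z₀)) * (1 + ℓ (y - z) * h (ℓ (y - z))),
      ⟨fun h => by simp [h] at hv, ?_, eventually_mem_hyperplanes_iff hz, ?_⟩, by simp⟩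
    · have h1 : AnalyticAt ℂ (fun y : V => h (ℓ (y - z))) z := by
        refine AnalyticAt.fun_comp (g := h) ?_ (hlin z z)
        simpa using hh
      exact analyticAt_const.mul (analyticAt_const.add ((hlin z z).mul h1))
    · filter_upwards [eventually_mem_hyperplanes_iff hz] with y hy hyZ
      have hne : ℓ (y - z) ≠ 0 := fun h => hyZ (hy.2 h)
      rw [show y - z₀ = (y - z) + (z - z₀) by abel, map_add, hf _ _ hz, hfh, smul_eq_mul]
      field_simp

end Model

theorem completeSpace_submodule {E : Type*} [NormedAddCommGroup E] [NormedSpace ℂ E]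
    [FiniteDimensional ℂ E] (p : Submodule ℂ E) : CompleteSpace p :=
  FiniteDimensional.complete ℂ p

/-! ### Existence and uniqueness of the sections. -/

section Main

variable [FiniteDimensional ℂ V] [DiscreteTopology Γ] [IsZLattice ℝ Γ]
variable {χ : AutFactor Γ} {κ : ℂ → ℂ} {H : Set (V ⧸ Γ)} {ℓ : V →L[ℂ] ℂ} {v z₀ : V}
variable {U : Type*} [NormedAddCommGroup U] [NormedSpace ℂ U]

/-- The line bundle with a nontrivial unitary factor of automorphy pulled back along `ℓ` has a
section with a simple pole on the hypertorus, unique up to scaling. -/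
theorem exists_section_simple_pole [DiscreteTopology (imageLattice Γ ℓ)] (hv : ℓ v = 1)
    (hH : ∀ z, proj Γ z ∈ H ↔ z ∈ hyperplanes Γ ℓ z₀) (hκ : ∀ u, ‖κ u‖ = 1)
    (hadd : ∀ a b, κ (a + b) = κ a * κ b) (hnt : ∃ γ ∈ Γ, κ (ℓ γ) ≠ 1)
    (hχ : ∀ (γ : Γ) z, (χ.toFun γ z : ℂ) = κ (ℓ γ)) :
    ∃ s : SectionOff χ ℂ H, s.IsMeromorphicWithSimplePole ∧
      ∀ t : SectionOff χ ℂ H, t.IsMeromorphicWithSimplePole →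
        ∃ c : ℂ, ∀ x, t.toFun x = (s.toFun x).smul c := by
  have hHset : {y | proj Γ y ∈ H} = hyperplanes Γ ℓ z₀ := Set.ext hH
  have hHset' : {y | proj Γ y ∉ H} = (hyperplanes Γ ℓ z₀)ᶜ := by rw [← hHset]; rfl
  have := isZLattice_imageLattice (Γ := Γ) hv
  obtain ⟨F, hFa, hFq, hFp⟩ := exists_quasiperiodic_hyperplanes hv hκ hadd hnt z₀
  obtain ⟨s, hs⟩ := exists_section_of_quasiperiodic (χ := χ) (H := H) F
    fun z _ γ => by rw [hFq z γ γ.2, hχ, smul_eq_mul]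
  refine ⟨s, ⟨⟨F, hs, hHset' ▸ hFa⟩, fun f hf z hz => ?_⟩, fun t ht => ?_⟩
  · obtain ⟨h, hh, hhz⟩ := hFp z ((hH z).1 hz)
    refine ⟨ℓ, h, ?_, ?_⟩
    · rw [hHset]
      exact hh.congr fun y hy => hs.eq hf fun h => hy ((hH y).1 h)
    -- As `z` itself lies over `H`, it is enough that the numerator is nonzero at `z`.
    · refine Filter.Frequently.filter_mono (f := pure z) ?_ (pure_le_nhdsWithin hz)
      rw [frequently_pure, hhz]
      exact norm_ne_zero_iff.1 (by rw [hκ]; exact one_ne_zero)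
  · obtain ⟨⟨f, hf, hfa⟩, hpole⟩ := ht
    rw [hHset'] at hfa
    have hfq : ∀ y ∉ hyperplanes Γ ℓ z₀, ∀ γ ∈ Γ, f (y + γ) = κ (ℓ γ) • f y := by
      intro y hy γ hγ
      rw [← hχ ⟨γ, hγ⟩ y]
      exact hf.apply_add (fun h => hy ((hH y).1 h)) ⟨γ, hγ⟩
    have hfp : ∀ z ∈ hyperplanes Γ ℓ z₀, ∃ h, IsPolarForm (hyperplanes Γ ℓ z₀) f z ℓ h := by
      intro z hz
      obtain ⟨ℓ', h, hp, -⟩ := hpole f hf z ((hH z).2 hz)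
      rw [hHset] at hp
      exact ⟨_, (hp.normalize hv hz).2.2⟩
    -- The residue of `f` is `c` times that of the model `F`, so `c` is the required scalar.
    obtain ⟨c, hc⟩ := residue_eq hv hκ hfq hfp
    refine ⟨c, ?_⟩
    have h0 := eq_of_residue_eq (G := fun y => F y • c) hv hκ hnt hfa
      (analyticOnNhd_smul_const hFa c) hfq
      (fun y hy γ hγ => by rw [hFq y γ hγ, mul_smul])
      (fun z hz => by
        obtain ⟨h, hh⟩ := hfp z hz
        obtain ⟨h', hh', hz'⟩ := hFp z hz
        refine ⟨_, _, hh, hh'.smul_right c, ?_⟩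
        rw [(hh.hasLineResidue hv hz).unique (hc z hz), hz'])
    rintro ⟨x, hx⟩
    obtain ⟨z, rfl⟩ := Submodule.Quotient.mk_surjective Γ x
    have hz := h0 z fun h => hx ((hH z).2 h)
    refine (hf z hx).trans ?_
    rw [hz, smul_eq_mul, mul_comm]
    exact (congrArg (Bundle.smul c) (hs z hx)).symm

/-- The tensor product of that bundle with the conormal line has a unique section with a simple pole
on the hypertorus and residue `1`. -/
theorem existsUnique_section_residue_one {α : AntiDual V} {gH : V ≃ₗ[ℂ] V} [DiscreteTopology (imageLattice Γ ℓ)] (hv : ℓ v = 1)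
    (hH : ∀ z, proj Γ z ∈ H ↔ z ∈ hyperplanes Γ ℓ z₀)
    (hgH : ∀ z, gH z = z ↔ ℓ z = 0) {w : latticeAut Γ}
    (hw : ∀ p, ℓ p = 0 → (w : V ≃ₗ[ℂ] V) p = p)
    (hwH : ∀ z, proj Γ z ∈ H → (w : V ≃ₗ[ℂ] V).symm z - z ∈ Γ)
    (hnt : ∃ γ ∈ Γ, lineChar (twistForm α (w : V ≃ₗ[ℂ] V)) v (ℓ γ) ≠ 1) :
    ∃! f : SectionOff (twistFactor Γ α (w : V ≃ₗ[ℂ] V)) (dualVH gH) H,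
      f.IsMeromorphicWithSimplePole ∧
      ∃ r : H → Bundle (twistFactor Γ α (w : V ≃ₗ[ℂ] V)) ℂ,
        f.HasResidue r ∧ IsUnitSection α w r := by
  have hHset : {y | proj Γ y ∈ H} = hyperplanes Γ ℓ z₀ := Set.ext hH
  have hHset' : {y | proj Γ y ∉ H} = (hyperplanes Γ ℓ z₀)ᶜ := by rw [← hHset]; rfl
  have := isZLattice_imageLattice (Γ := Γ) hv
  have : CompleteSpace (dualVH gH) := completeSpace_submodule _
  set κ := lineChar (twistForm α (w : V ≃ₗ[ℂ] V)) v with hκdef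
  have hκ : ∀ u, ‖κ u‖ = 1 := norm_lineChar _ _
  have hadd : ∀ a b, κ (a + b) = κ a * κ b := lineChar_add _ _
  have hκapp : ∀ z, κ (ℓ z) =
      Complex.exp (2 * Real.pi * Complex.I * (omega (twistForm α (w : V ≃ₗ[ℂ] V)) z : ℂ)) :=
    lineChar_apply hv fun p hp => twistForm_eq_zero (hw p hp)
  have hχ : ∀ (γ : Γ) z, ((twistFactor Γ α (w : V ≃ₗ[ℂ] V)).toFun γ z : ℂ) = κ (ℓ γ) := by
    intro γ z
    rw [twistFactor_apply, hκapp]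
  obtain ⟨F, hFa, hFq, hFp⟩ := exists_quasiperiodic_hyperplanes hv hκ hadd hnt z₀
  set L : dualVH gH := ⟨ℓ, fun z hz => (hgH z).1 hz⟩ with hL
  have hL0 : L ≠ 0 := fun h => by
    have : ℓ = 0 := congrArg Subtype.val h
    simp [this] at hv
  -- The factor `κ(ℓ z₀)` turns the residue `κ(ℓ(z - z₀))` of `F` into `κ(ℓ z)`, the value of the
  -- canonical trivialization.
  set G : V → dualVH gH := fun y => F y • κ (ℓ z₀) • L with hG
  have hGa : AnalyticOnNhd ℂ G (hyperplanes Γ ℓ z₀)ᶜ :=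
    analyticOnNhd_smul_const hFa _
  have hGq : ∀ y, ∀ γ ∈ Γ, G (y + γ) = κ (ℓ γ) • G y := by
    intro y γ hγ
    simp only [hG, hFq y γ hγ, mul_smul]
  have hGp : ∀ z ∈ hyperplanes Γ ℓ z₀, ∃ h, IsPolarForm (hyperplanes Γ ℓ z₀) G z ℓ h ∧
      h z = κ (ℓ z) • L := by
    intro z hz
    obtain ⟨h, hh, hhz⟩ := hFp z hz
    refine ⟨_, hh.smul_right (κ (ℓ z₀) • L), ?_⟩
    rw [hhz, smul_smul, ← hadd, ← map_add, sub_add_cancel]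
  obtain ⟨s, hs⟩ := exists_section_of_quasiperiodic
    (χ := twistFactor Γ α (w : V ≃ₗ[ℂ] V)) (H := H) G fun z _ γ => by rw [hGq z γ γ.2, hχ]
  obtain ⟨r, hr⟩ := exists_bundle_map_of_quasiperiodic
    (χ := twistFactor Γ α (w : V ≃ₗ[ℂ] V)) (S := H) (fun z => κ (ℓ z))
    fun z _ γ => by rw [hχ, map_add, hadd, smul_eq_mul, mul_comm]
  have hpolar : ∀ f, s.IsLift f → ∀ z, proj Γ z ∈ H → ∃ h,
      IsPolarForm {y | proj Γ y ∈ H} f z ℓ h ∧ h z = κ (ℓ z) • L := by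
    intro f hf z hz
    obtain ⟨h, hh, hhz⟩ := hGp z ((hH z).1 hz)
    refine ⟨h, ?_, hhz⟩
    rw [hHset]
    exact hh.congr fun y hy => hs.eq hf fun h => hy ((hH y).1 h)
  have hne : ∀ u, κ u ≠ 0 := fun u => norm_ne_zero_iff.1 (by rw [hκ]; exact one_ne_zero)
  refine ⟨s, ⟨⟨⟨G, hs, hHset' ▸ hGa⟩, fun f hf z hz => ?_⟩, r, fun f hf z hz => ?_, fun z hz => ?_⟩,
    fun t ht => ?_⟩
  · obtain ⟨h, hh, hhz⟩ := hpolar f hf z hz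
    refine ⟨ℓ, h, hh, Filter.Frequently.filter_mono (f := pure z) ?_ (pure_le_nhdsWithin hz)⟩
    rw [frequently_pure, hhz]
    exact smul_ne_zero (hne _) hL0
  · obtain ⟨h, hh, hhz⟩ := hpolar f hf z hz
    exact ⟨ℓ, h, hh, κ (ℓ z), by rw [hhz]; rfl, hr z hz⟩
  · exact ⟨κ (ℓ z), hr z hz, (mk_eq_twistMap_iff w (hwH z hz) _).2 (hκapp z)⟩
  · obtain ⟨⟨⟨f, hf, hfa⟩, -⟩, r', hres, hunit⟩ := ht
    rw [hHset'] at hfa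
    have hfp : ∀ z ∈ hyperplanes Γ ℓ z₀, ∃ h, IsPolarForm (hyperplanes Γ ℓ z₀) f z ℓ h ∧
        h z = κ (ℓ z) • L := by
      intro z hz
      obtain ⟨ℓ', h, hp, c, hhz, hrc⟩ := hres f hf z ((hH z).2 hz)
      obtain ⟨c', hrc', hc'⟩ := hunit z ((hH z).2 hz)
      have hcc : c = c' := Bundle.mk_injective z (hrc.symm.trans hrc')
      rw [mk_eq_twistMap_iff w (hwH z ((hH z).2 hz)), ← hκapp] at hc'
      rw [hHset] at hp
      obtain ⟨hne', he, hp'⟩ := hp.normalize hv hz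
      refine ⟨_, hp', Subtype.ext ?_⟩
      change (ℓ' v)⁻¹ • (h z : V →L[ℂ] ℂ) = κ (ℓ z) • ℓ
      -- The residue does not depend on the local equation: `ℓ' = ℓ'(v) • ℓ`, and normalizing
      -- divides the numerator by the same `ℓ'(v)`.
      rw [hhz, hcc, hc', smul_comm]
      congr 1
      rw [inv_smul_eq_iff₀ hne']
      exact he
    refine SectionOff.ext_of_isLift hf hs fun z hz => ?_
    refine eq_of_residue_eq hv hκ hnt hfa hGa (fun y hy γ hγ => ?_) (fun y _ => hGq y)
      (fun z hz => ?_) z fun h => hz ((hH z).2 h)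
    · rw [← hχ ⟨γ, hγ⟩ y]
      exact hf.apply_add (fun h => hy ((hH y).1 h)) ⟨γ, hγ⟩
    · obtain ⟨h, hh, hz₁⟩ := hfp z hz
      obtain ⟨h', hh', hz₂⟩ := hGp z hz
      exact ⟨h, h', hh, hh', hz₁.trans hz₂.symm⟩

end Main

/-- The determinant of `g` is a primitive root of unity of order `n_H`, so no power with exponent
strictly between `0` and `n_H` is trivial. -/
theorem pow_ne_one_of_isDistinguishedGenerator {W : Subgroup (latticeAut Γ)} {H : Set (V ⧸ Γ)}
    {g : W} (hg : IsDistinguishedGenerator W H g) {j : ℕ} (hj₁ : 1 ≤ j)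
    (hj₂ : j < genericOrder W H) : g ^ j ≠ 1 := by
  intro h
  have hprim := Complex.isPrimitiveRoot_exp (genericOrder W H) (by omega)
  let D : W →* ℂ := LinearMap.det.comp
    ((LinearEquiv.automorphismGroup.toLinearMapMonoidHom (R := ℂ) (M := V)).comp
      ((latticeAut Γ).subtype.comp W.subtype))
  have hD : D g = Complex.exp (2 * Real.pi * Complex.I / (genericOrder W H : ℂ)) := hg.2
  have h1 : D g ^ j = 1 := by rw [← map_pow, h, map_one]
  rw [hD] at h1
  exact absurd (Nat.le_of_dvd hj₁ (hprim.dvd_of_pow_eq_one j h1)) (by omega)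

end EllipticDunkl
end

theorem lemma3p2 {V : Type*} [NormedAddCommGroup V] [NormedSpace ℂ V] [FiniteDimensional ℂ V]
    (Γ : Submodule ℤ V) [DiscreteTopology Γ] [IsZLattice ℝ Γ]
    (W : Subgroup (latticeAut Γ)) [Finite W]
    (α : AntiDual V) (hα : HasTrivialStabilizer W α)
    (H : Set (V ⧸ Γ)) (hH : IsReflectionHypertorus W H)
    (gH : W) (hgH : IsDistinguishedGenerator W H gH)
    (j : ℕ) (hj₁ : 1 ≤ j) (hj₂ : j < genericOrder W H) :
    -- the line bundle `(𝓛^{g_H^j})^* ⊗ 𝓛`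
    (∃ s : SectionOff (twistFactor Γ α ((gH ^ j : W) : latticeAut Γ)) ℂ H,
      s.IsMeromorphicWithSimplePole ∧
      ∀ t : SectionOff (twistFactor Γ α ((gH ^ j : W) : latticeAut Γ)) ℂ H,
        t.IsMeromorphicWithSimplePole → ∃ c : ℂ, ∀ x, t.toFun x = (s.toFun x).smul c) ∧
    -- the bundle `(𝓛^{g_H^j})^* ⊗ 𝓛 ⊗ V_H^*`
    (∃! f : SectionOff (twistFactor Γ α ((gH ^ j : W) : latticeAut Γ))
        (dualVH ((gH : latticeAut Γ) : V ≃ₗ[ℂ] V)) H,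
      f.IsMeromorphicWithSimplePole ∧
      ∃ r : H → Bundle (twistFactor Γ α ((gH ^ j : W) : latticeAut Γ)) ℂ,
        f.HasResidue r ∧ IsUnitSection α ((gH ^ j : W) : latticeAut Γ) r) := by
  obtain ⟨g, hg, ⟨x, hx, rfl⟩, -⟩ := hH
  obtain ⟨z₀, rfl⟩ := Submodule.Quotient.mk_surjective Γ x
  obtain ⟨ℓ, v, v₁, hv, hv₁, hform⟩ := exists_linearForm_of_isReflection hg
  have := discreteTopology_imageLattice (Γ := Γ) hv₁ hform
  have hmem := proj_mem_connectedComponentIn_iff hv₁ hform hx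
  set H := connectedComponentIn (MulAction.fixedBy (V ⧸ Γ) g) (proj Γ z₀) with hHdef
  have hfix : ∀ w ∈ genericStabilizer W H, ∀ z, proj Γ z ∈ H →
      ((w : latticeAut Γ) : V ≃ₗ[ℂ] V) z - z ∈ Γ := by
    intro w hw z hz
    have h := (mem_fixingSubgroup_iff W).1 hw _ hz
    exact proj_eq_proj_iff.1 h
  have hker : ∀ w ∈ genericStabilizer W H, ∀ p, ℓ p = 0 →
      ((w : latticeAut Γ) : V ≃ₗ[ℂ] V) p = p := fun w hw p hp =>
    apply_eq_self_of_fixes (fun z hz => hfix w hw z ((hmem z).2 hz)) hp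
  have hpow : gH ^ j ∈ genericStabilizer W H := Subgroup.pow_mem _ hgH.1 j
  have hne : gH ^ j ≠ 1 := pow_ne_one_of_isDistinguishedGenerator hgH hj₁ hj₂
  have hnt := exists_lineChar_ne_one hv hα hne (hker _ hpow)
  have hlift : ∀ p, ℓ p = 0 → twistForm α (((gH ^ j : W) : latticeAut Γ) : V ≃ₗ[ℂ] V) p = 0 :=
    fun p hp => twistForm_eq_zero (hker _ hpow p hp)
  refine ⟨exists_section_simple_pole hv hmem (norm_lineChar _ _) (lineChar_add _ _) hnt
    fun γ z => by rw [twistFactor_apply, lineChar_apply hv hlift], ?_⟩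
  refine existsUnique_section_residue_one hv hmem (fun z => ⟨fun hz => ?_, hker gH hgH.1 z⟩)
    (hker _ hpow) (fun z hz => ?_) hnt
  -- A fixed vector off `ker ℓ` would span `V` together with `ker ℓ`, making `g_H` the identity,
  -- against `g_H ^ j ≠ 1`.
  · by_contra hℓz
    have hgH1 : gH = 1 := by
      refine Subtype.ext (Subtype.ext (LinearEquiv.ext fun y => ?_))
      have h1 := hker gH hgH.1 (y - (ℓ y / ℓ z) • z)
        (by rw [map_sub, map_smul, smul_eq_mul, div_mul_cancel₀ _ hℓz, sub_self])
      rw [map_sub, map_smul, hz] at h1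
      exact sub_left_injective h1
    exact hne (by rw [hgH1, one_pow])
  -- Applying `w` turns `w⁻¹ z - z` into `z - w z`, which lies in `Γ` because `w` fixes `H`
  -- pointwise.
  · set w : latticeAut Γ := ((gH ^ j : W) : latticeAut Γ)
    refine (w.2 _).1 ?_
    rw [map_sub, LinearEquiv.apply_symm_apply, ← neg_sub]
    exact Γ.neg_mem (hfix _ hpow z hz)
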